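/- **Setting.** Let $(\Omega,\mathcal F,\mathbb P)$ be a probability space and $\sigma\colon\Omega\to\Omega$ an invertible (bimeasurable), $\mathbb P$-preserving, ergodic transformation. Let $M$ be a metric space with its Borel $\sigma$-algebra $\mathcal B$, let $T_\omega\colon M\to M$ ($\omega\in\Omega$) be maps such that $(\omega,x)\mapsto T_\omega x$ is measurable, and let $(\mu_\omega)_{\omega\in\Omega}$ be a measurable family of Borel probability measures on $M$ with $(T_\omega)_*\mu_\omega=\mu_{\sigma\omega}$ for $\mathbb P$-a.e. $\omega$. Put $T^{(n)}_\omega=T_{\sigma^{n-1}\omega}\circ\dots\circ T_\omega$ and $\tau(\omega,x)=(\sigma\omega,T_\omega x)$, and let $\mu$ be the measure on $\Omega\times M$ with $\mu(A\times B)=\int_A\mu_\omega(B)\,d\mathbb P(\omega)$. Assume that $\tau$ is ergodic with respect to $\mu$. For $g\in L^1(\mu_\omega)$ let $L_\omega g$ be the density with respect to $\mu_{\sigma\omega}$ of the image under $T_\omega$ of the signed measure $g\,d\mu_\omega$, and put $L^{(n)}_\omega=L_{\sigma^{n-1}\omega}\circ\dots\circ L_\omega$. Let $(\mathcal H,\|\cdot\|_{\mathcal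 H})$ be a Banach space of real-valued functions on $M$ that contains the constants and such that for $\mathbb P$-a.e. $\omega$: every $\varphi\in\mathcal H$ satisfies $\|\varphi\|_{L^\infty(\mu_\omega)}\le\|\varphi\|_{\mathcal H}$, and $L_\omega$ acts as a bounded linear operator on $\mathcal H$. Let $K\colon\Omega\to[1,\infty)$ and $A_n\colon\Omega\to(0,\infty)$ be measurable with $$\Big\|L^{(n)}_\omega\varphi-\int_M\varphi\,d\mu_\omega\Big\|_{L^\infty(\mu_{\sigma^n\omega})}\le K(\omega)A_n(\omega)\|\varphi\|_{\mathcal H}\qquad\text{for $\mathbb P$-a.e. }\omega,\text{ all }\varphi\in\mathcal H,\ n\ge1,$$ and let $q_0\in[4,\infty]$ be such that $\sum_{j\ge1}\|A_j\|_{L^{q_0}(\mathbb P)}<\infty$. **Theorem.** Let $p,r,s\in(0,\infty]$ satisfy $\frac1r+\frac1{q_0}\le\frac12$ (that is, $r\ge\frac{2q_0}{q_0-2}$), $s>2$ and $$\frac1s=\frac1r+\frac1p+\frac1{q_0},$$ and suppose that $K\in L^r(\mathbb P)$. Let $v=(v^1,\dots,v^e)\colon\Omega\times M\to\mathbb R^e$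 be measurable, with $v_\omega:=v(\omega,\cdot)\in\mathcal H^e$ and $\int_Mv_\omega\,d\mu_\omega=0$ for $\mathbb P$-a.e. $\omega$, and with $\omega\mapsto\|v_\omega\|_{\mathcal H}=\max_i\|v^i_\omega\|_{\mathcal H}$ in $L^p(\mathbb P)$. Then: 1. For $\mathbb P$-a.e. $\omega$ the series $\chi_\omega=\sum_{n=1}^\infty L^{(n)}_{\sigma^{-n}\omega}(v_{\sigma^{-n}\omega})$ converges absolutely in $L^\infty(\mu_\omega)$. If $M$ is separable, there is a measurable $\chi\colon\Omega\times M\to\mathbb R^e$ with $\chi(\omega,\cdot)=\chi_\omega$ $\mu_\omega$-a.e. for $\mathbb P$-a.e. $\omega$. For any measurable $\chi$ with this last property, set $m=v+\chi-\chi\circ\tau$, i.e. $m_\omega=v_\omega+\chi_\omega-\chi_{\sigma\omega}\circ T_\omega$, and for $t\ge0$, $1\le\beta,\gamma\le e$ put $$\mathbb W^{\beta\gamma}_{\omega,n}(t)=\frac1n\sum_{0\le i<j\le[nt]-1}\big(v^\beta_{\sigma^i\omega}\circ T^{(i)}_\omega\big)\big(v^\gamma_{\sigma^j\omega}\circ T^{(j)}_\omega\big),$$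 and define $\mathbb M^{\beta\gamma}_{\omega,n}$ in the same way with $m$ in place of $v$. Then for all $1\le\beta,\gamma\le e$: 2. The functions $v^\beta\cdot(v^\gamma\circ\tau^j)$ and $m^\beta\cdot(m^\gamma\circ\tau^j)$ ($j\ge0$) are $\mu$-integrable, and the limit $$S^{\beta\gamma}=\lim_{n\to\infty}\sum_{j=1}^n\int_{\Omega\times M}\big(v^\beta\cdot(v^\gamma\circ\tau^j)-m^\beta\cdot(m^\gamma\circ\tau^j)\big)\,d\mu$$ exists in $\mathbb R$. 3. For $\mathbb P$-a.e. $\omega$ and $\mu_\omega$-a.e. point of $M$, $\mathbb W^{\beta\gamma}_{\omega,n}(t)-\mathbb M^{\beta\gamma}_{\omega,n}(t)\to t\,S^{\beta\gamma}$ as $n\to\infty$, uniformly for $t$ in compact subsets of $[0,\infty)$. 4. For $\mathbb P$-a.e. $\omega$, the weak limits, as $n\to\infty$, of the processes (on the probability space $(M,\mu_\omega)$, with values in the Skorokhod space $D([0,\infty),\mathbb R)$) $$\mathbb W^{\beta\gamma}_{\omega,n}(t)-t\sum_{j=1}^n\int_{\Omega\times M}v^\beta\cdot(v^\gamma\circ\tau^j)\,d\mu\quad\text{and}\quad\mathbb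 M^{\beta\gamma}_{\omega,n}(t)-t\sum_{j=1}^n\int_{\Omega\times M}m^\beta\cdot(m^\gamma\circ\tau^j)\,d\mu$$ coincide: if one of them converges weakly to a Borel probability law on $D([0,\infty),\mathbb R)$, then so does the other, to the same law. -/

import Mathlib

open MeasureTheory ProbabilityTheory Filter Topology Set
open scoped NNReal ENNReal

noncomputable section

namespace IteratedWIP

/-! ### The Skorokhod space `D([0, ∞), ℝ)` -/

/-- A function on `[0, ∞)` is càdlàg if it is right-continuous and has left limits. -/
def IsCadlag (f : ℝ≥0 → ℝ) : Prop :=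
  ∀ t, ContinuousWithinAt f (Ici t) t ∧ ∃ l, Tendsto f (𝓝[<] t) (𝓝 l)

/-- The space `D([0, ∞), ℝ)` of càdlàg functions. -/
def Skorokhod : Type := {f : ℝ≥0 → ℝ // IsCadlag f}

/-- The pairs `(x, y)` for which some increasing homeomorphism `lam` of `[0, ∞)` satisfies
`|lam t - t| < ε` and `|x (lam t) - y t| < ε` for all `t ≤ T`. -/
def skorokhodEntourage (T ε : ℝ) : Set (Skorokhod × Skorokhod) :=
  {p | ∃ lam : ℝ≥0 ≃o ℝ≥0, ∀ t : ℝ≥0, (t : ℝ) ≤ T →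
    dist (lam t) t < ε ∧ dist (p.1.1 (lam t)) (p.2.1 t) < ε}

theorem skorokhodEntourage_mono {T T' ε ε' : ℝ} (hT : T' ≤ T) (hε : ε ≤ ε') :
    skorokhodEntourage T ε ⊆ skorokhodEntourage T' ε' := by
  rintro p ⟨lam, h⟩
  exact ⟨lam, fun t ht => ⟨(h t (ht.trans hT)).1.trans_le hε, (h t (ht.trans hT)).2.trans_le hε⟩⟩

/-- The filter basis made of all `skorokhodEntourage T ε` with `0 < T` and `0 < ε`. -/
def skorokhodBasis : FilterBasis (Skorokhod × Skorokhod) where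
  sets := {U | ∃ T ε : ℝ, 0 < T ∧ 0 < ε ∧ U = skorokhodEntourage T ε}
  nonempty := ⟨_, 1, 1, one_pos, one_pos, rfl⟩
  inter_sets := by
    rintro _ _ ⟨T, ε, hT, hε, rfl⟩ ⟨T', ε', hT', hε', rfl⟩
    exact ⟨_, ⟨max T T', min ε ε', lt_max_of_lt_left hT, lt_min hε hε', rfl⟩,
      subset_inter (skorokhodEntourage_mono (le_max_left _ _) (min_le_left _ _))
        (skorokhodEntourage_mono (le_max_right _ _) (min_le_right _ _))⟩

theorem skorokhodEntourage_symm {T ε : ℝ} (hT : 0 < T) (hε : 0 < ε) :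
    skorokhodEntourage (T + ε) ε ⊆ Prod.swap ⁻¹' skorokhodEntourage T ε := by
  rintro ⟨x, y⟩ ⟨lam, h⟩
  refine ⟨lam.symm, fun s hs => ?_⟩
  have key : ((lam.symm s : ℝ≥0) : ℝ) ≤ T + ε := by
    by_contra! hlt
    obtain ⟨a, ha⟩ : ∃ a : ℝ≥0, (a : ℝ) = T + ε :=
      ⟨(T + ε).toNNReal, Real.coe_toNNReal _ (by positivity)⟩
    have h1 := (h a ha.le).1
    have h2 : lam a < s := by
      have h3 : a < lam.symm s := by
        rw [← NNReal.coe_lt_coe, ha]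
        exact hlt
      simpa using lam.strictMono h3
    rw [← NNReal.coe_lt_coe] at h2
    rw [NNReal.dist_eq, abs_lt] at h1
    linarith [h1.1]
  have h1 := h (lam.symm s) key
  simp only [OrderIso.apply_symm_apply] at h1
  exact ⟨by rw [dist_comm]; exact h1.1, by rw [dist_comm]; exact h1.2⟩

theorem skorokhodEntourage_comp {x y z : Skorokhod} {T ε : ℝ}
    (h₁ : (x, y) ∈ skorokhodEntourage (T + ε / 2) (ε / 2))
    (h₂ : (y, z) ∈ skorokhodEntourage (T + ε / 2) (ε / 2)) (hε : 0 < ε) :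
    (x, z) ∈ skorokhodEntourage T ε := by
  obtain ⟨lam, h₁⟩ := h₁
  obtain ⟨rho, h₂⟩ := h₂
  refine ⟨rho.trans lam, fun t ht => ?_⟩
  have a := h₂ t (by linarith)
  have hr : ((rho t : ℝ≥0) : ℝ) ≤ T + ε / 2 := by
    have := a.1
    rw [NNReal.dist_eq, abs_lt] at this
    linarith [this.2]
  have b := h₁ (rho t) hr
  simp only [OrderIso.trans_apply]
  constructor
  · linarith [dist_triangle (lam (rho t)) (rho t) t, a.1, b.1]
  · have := dist_triangle (x.1 (lam (rho t))) (y.1 (rho t)) (z.1 t)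
    have a2 := a.2
    have b2 := b.2
    simp only at a2 b2
    linarith

/-- The uniform structure whose topology is the Skorokhod `J₁` topology on `D([0, ∞), ℝ)`:
`x k → y` iff for every `T` there are increasing homeomorphisms `lam k` of `[0, ∞)` such that
`lam k t - t → 0` and `x k (lam k t) - y t → 0` uniformly in `t ≤ T`. -/
instance : UniformSpace Skorokhod :=
  UniformSpace.ofCore <| UniformSpace.Core.mkOfBasis skorokhodBasis
    (by
      rintro _ ⟨T, ε, hT, hε, rfl⟩ x
      exact ⟨OrderIso.refl _, fun t _ => by simpa using hε⟩)
    (by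
      rintro _ ⟨T, ε, hT, hε, rfl⟩
      exact ⟨_, ⟨T + ε, ε, by positivity, hε, rfl⟩, skorokhodEntourage_symm hT hε⟩)
    (by
      rintro _ ⟨T, ε, hT, hε, rfl⟩
      refine ⟨_, ⟨T + ε / 2, ε / 2, by positivity, by positivity, rfl⟩, ?_⟩
      rintro ⟨x, z⟩ ⟨y, h₁, h₂⟩
      exact skorokhodEntourage_comp h₁ h₂ hε)

/-- `D([0, ∞), ℝ)` carries the Borel `σ`-algebra of the Skorokhod topology. -/
instance : MeasurableSpace Skorokhod := borel Skorokhod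

instance : BorelSpace Skorokhod := ⟨rfl⟩

/-! ### Random dynamics -/

section Dynamics

variable {Ω M : Type*}

/-- `T_ω^{(n)} = T_{σ^{n-1} ω} ∘ ⋯ ∘ T_ω`. -/
def cocycle (σ : Ω → Ω) (T : Ω → M → M) : ℕ → Ω → M → M
  | 0, _, x => x
  | n + 1, ω, x => T (σ^[n] ω) (cocycle σ T n ω x)

/-- The skew product `τ (ω, x) = (σ ω, T_ω x)`. -/
def skewProduct (σ : Ω → Ω) (T : Ω → M → M) (z : Ω × M) : Ω × M :=
  (σ z.1, T z.1 z.2)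

variable [MeasurableSpace Ω] [MeasurableSpace M]

/-- The transfer operator: `L_ω g` is the density with respect to `μ_{σ ω}` of the image under
`T_ω` of the signed measure `g dμ_ω`. -/
def transfer (σ : Ω → Ω) (T : Ω → M → M) (κ : Kernel Ω M) (ω : Ω) (g : M → ℝ) : M → ℝ :=
  SignedMeasure.rnDeriv (((κ ω).withDensityᵥ g).map (T ω)) (κ (σ ω))

/-- `L_ω^{(n)} = L_{σ^{n-1} ω} ∘ ⋯ ∘ L_ω`. -/
def transferIter (σ : Ω → Ω) (T : Ω → M → M) (κ : Kernel Ω M) : ℕ → Ω → (M → ℝ) → M → ℝ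
  | 0, _, g => g
  | n + 1, ω, g => transfer σ T κ (σ^[n] ω) (transferIter σ T κ n ω g)

variable {e : ℕ}

/-- The `n`-th term `L_{σ^{-n} ω}^{(n)} (v^i_{σ^{-n} ω})` of the series that defines `χ^i_ω`. -/
def chiTerm (σ : Ω ≃ᵐ Ω) (T : Ω → M → M) (κ : Kernel Ω M) (v : Ω × M → Fin e → ℝ)
    (i : Fin e) (n : ℕ) (ω : Ω) : M → ℝ :=
  transferIter σ T κ n (σ.symm^[n] ω) (fun x => v (σ.symm^[n] ω, x) i)

/-- `χ` is given by `χ_ω = ∑_{n ≥ 1} L_{σ^{-n} ω}^{(n)} (v_{σ^{-n} ω})`: for almost every `ω` this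
holds `μ_ω`-almost everywhere (the terms, being densities, are only defined up to null sets). -/
def IsChi (P : Measure Ω) (σ : Ω ≃ᵐ Ω) (T : Ω → M → M) (κ : Kernel Ω M)
    (v χ : Ω × M → Fin e → ℝ) : Prop :=
  ∀ᵐ ω ∂P, ∀ i, ∀ᵐ x ∂(κ ω), χ (ω, x) i = ∑' n : ℕ, chiTerm σ T κ v i (n + 1) ω x

end Dynamics

section Processes

variable {Ω M : Type*} {e : ℕ}

/-- `m_ω = v_ω + χ_ω - χ_{σ ω} ∘ T_ω`. -/
def martingalePart (σ : Ω → Ω) (T : Ω → M → M) (v χ : Ω × M → Fin e → ℝ) :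
    Ω × M → Fin e → ℝ :=
  fun z => v z + χ z - χ (skewProduct σ T z)

/-- `∑_{0 ≤ i < j ≤ N - 1} (v_{σ^i ω}^β ∘ T_ω^{(i)}) (v_{σ^j ω}^γ ∘ T_ω^{(j)})` at the point `x`. -/
def iteratedSum (σ : Ω → Ω) (T : Ω → M → M) (v : Ω × M → Fin e → ℝ) (β γ : Fin e)
    (ω : Ω) (x : M) (N : ℕ) : ℝ :=
  ∑ j ∈ Finset.range N, ∑ i ∈ Finset.range j,
    v (σ^[i] ω, cocycle σ T i ω x) β * v (σ^[j] ω, cocycle σ T j ω x) γ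

/-- The process `𝕎_{ω,n}^{βγ}(t)`, evaluated at the point `x`. -/
def iteratedProcess (σ : Ω → Ω) (T : Ω → M → M) (v : Ω × M → Fin e → ℝ) (β γ : Fin e)
    (ω : Ω) (n : ℕ) (x : M) (t : ℝ≥0) : ℝ :=
  (1 / (n : ℝ)) * iteratedSum σ T v β γ ω x ⌊(n : ℝ≥0) * t⌋₊

/-- The function `v^β · (v^γ ∘ τ^j)` on `Ω × M`. -/
def lagProduct (σ : Ω → Ω) (T : Ω → M → M) (v : Ω × M → Fin e → ℝ) (β γ : Fin e) (j : ℕ)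
    (z : Ω × M) : ℝ :=
  v z β * v ((skewProduct σ T)^[j] z) γ

theorem isCadlag_floor (g : ℕ → ℝ) (c : ℝ≥0) : IsCadlag (fun t => g ⌊c * t⌋₊) := by
  intro t
  have hc : Tendsto (fun s : ℝ≥0 => c * s) (𝓝 t) (𝓝 (c * t)) :=
    (continuous_const.mul continuous_id).tendsto t
  constructor
  · have h : ∀ᶠ s in 𝓝[≥] t, g ⌊c * s⌋₊ = g ⌊c * t⌋₊ := by
      filter_upwards [(hc.mono_left nhdsWithin_le_nhds).eventually_lt_const
        (Nat.lt_floor_add_one (c * t)), self_mem_nhdsWithin] with s hs hts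
      congr 1
      exact (Nat.floor_eq_iff zero_le).2
        ⟨(Nat.floor_le zero_le).trans (mul_le_mul_right hts c), hs⟩
    exact tendsto_const_nhds.congr' (h.mono fun s hs => hs.symm)
  · refine ⟨g (⌈c * t⌉₊ - 1), ?_⟩
    rcases eq_or_ne (c * t) 0 with h0 | h0
    · have h : ∀ᶠ s in 𝓝[<] t, g (⌈c * t⌉₊ - 1) = g ⌊c * s⌋₊ := by
        filter_upwards [self_mem_nhdsWithin] with s hs
        have : c * s = 0 := le_antisymm ((mul_le_mul_right (le_of_lt hs) c).trans h0.le) zero_le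
        simp [h0, this]
      exact tendsto_const_nhds.congr' h
    · have hpos : 0 < ⌈c * t⌉₊ := Nat.ceil_pos.2 (pos_iff_ne_zero.2 h0)
      have hlt : ((⌈c * t⌉₊ - 1 : ℕ) : ℝ≥0) < c * t := Nat.lt_ceil.1 (Nat.sub_lt hpos one_pos)
      have hc0 : 0 < c := pos_iff_ne_zero.2 (left_ne_zero_of_mul h0)
      have h : ∀ᶠ s in 𝓝[<] t, g (⌈c * t⌉₊ - 1) = g ⌊c * s⌋₊ := by
        filter_upwards [(hc.mono_left nhdsWithin_le_nhds).eventually_const_lt hlt,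
          self_mem_nhdsWithin] with s hs hts
        congr 1
        refine ((Nat.floor_eq_iff zero_le).2 ⟨hs.le, ?_⟩).symm
        have h1 : c * s < c * t := mul_lt_mul_of_pos_left hts hc0
        have h2 : ((⌈c * t⌉₊ - 1 : ℕ) : ℝ≥0) + 1 = (⌈c * t⌉₊ : ℝ≥0) := by
          exact_mod_cast Nat.sub_add_cancel hpos
        rw [h2]
        exact h1.trans_le (Nat.le_ceil _)
      exact tendsto_const_nhds.congr' h

theorem isCadlag_recentered (σ : Ω → Ω) (T : Ω → M → M) (v : Ω × M → Fin e → ℝ) (β γ : Fin e)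
    (ω : Ω) (n : ℕ) (c : ℝ) (x : M) :
    IsCadlag (fun t => iteratedProcess σ T v β γ ω n x t - (t : ℝ) * c) := by
  intro t
  have hcont : Tendsto (fun s : ℝ≥0 => (s : ℝ) * c) (𝓝 t) (𝓝 ((t : ℝ) * c)) :=
    (NNReal.continuous_coe.mul continuous_const).tendsto t
  obtain ⟨h1, l, h2⟩ :=
    isCadlag_floor (fun N => (1 / (n : ℝ)) * iteratedSum σ T v β γ ω x N) n t
  exact ⟨Tendsto.sub h1 (hcont.mono_left nhdsWithin_le_nhds), l - t * c,
    h2.sub (hcont.mono_left nhdsWithin_le_nhds)⟩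

/-- The process `t ↦ 𝕎_{ω,n}^{βγ}(t) - t c`, as an element of `D([0, ∞), ℝ)` for each `x`. -/
def recenteredPath (σ : Ω → Ω) (T : Ω → M → M) (v : Ω × M → Fin e → ℝ) (β γ : Fin e)
    (ω : Ω) (n : ℕ) (c : ℝ) (x : M) : Skorokhod :=
  ⟨fun t => iteratedProcess σ T v β γ ω n x t - (t : ℝ) * c,
    isCadlag_recentered σ T v β γ ω n c x⟩

end Processes

end IteratedWIP

end

open IteratedWIP

/-! Write $U f=f\circ\tau$ on $L^2(\mu)$. The series for $\chi$ is $\sum_{n\ge1}(U^*)^n v$, computed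
fibre by fibre, so $m=v+\chi-U\chi$ satisfies $U^*m=U^*v+U^*\chi-\chi=0$: every $m^\beta$ is
orthogonal to all functions $f\circ\tau^k$ with $k\ge1$. This weak form of the identity,
`IsDualSum`, is all that the limit argument uses about transfer operators.

Summation by parts (`pairSum_sub_pairSum_cohomologous`) turns the difference of the iterated sums up
to time $N$ into a Birkhoff sum of $\chi^\beta v^\gamma-m^\beta\,(\chi^\gamma\circ\tau)$, minus
$\chi^\beta$ times the Birkhoff sum of $v^\gamma$, plus $(\chi^\gamma\circ\tau^N)$ times the
Birkhoff sum of $m^\beta$. After division by $N$, the ergodic theorem sends the first term to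
$\int\chi^\beta v^\gamma\,d\mu$, by orthogonality, and the second to $0$, because $v$ has mean zero.
The same integral is the limit of the lag sums, since the $m$-terms vanish and the $v$-terms are the
dual series tested against $v^\gamma$. Hence $S^{\beta\gamma}=\int\chi^\beta v^\gamma\,d\mu$.

The boundary term $(\chi^\gamma\circ\tau^N)\sum_{i<N}m^\beta\circ\tau^i=o(N)$ is the delicate one.
It needs $\chi\in L^q$ for some $q>2$: then $\chi\circ\tau^N=o(N^{1/q})$, while a Rademacher–Menshov
maximal inequality for orthogonal stationary sequences bounds the Birkhoff sums of $m$ by nearly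
$N^{1/2}$ (`ae_tendsto_mul_birkhoffSum_div`). Such a $q$ exists because decay and Hölder's
inequality dominate the terms of $\chi$ by random constants with summable $L^s(\mathbb P)$ norms,
$s>2$.

Convergence along integers gives locally uniform convergence of the processes. The difference of the
two centrings also tends to $S^{\beta\gamma}$, so the recentred paths become uniformly close on
compact sets almost surely and have the same weak limits. -/

namespace IteratedWIP

/-! ### The pointwise ergodic theorem -/

section Birkhoff

variable {X : Type*} {τ : X → X} {f : X → ℝ}

/-- The running maximum of `0` and the first `N` Birkhoff sums of `f`. -/
def birkhoffMax (τ : X → X) (f : X → ℝ) : ℕ → X → ℝ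
  | 0, _ => 0
  | N + 1, x => max 0 (f x + birkhoffMax τ f N (τ x))

theorem birkhoffMax_nonneg (N : ℕ) (x : X) : 0 ≤ birkhoffMax τ f N x := by
  cases N with
  | zero => exact le_rfl
  | succ N => exact le_max_left _ _

theorem birkhoffMax_mono (x : X) : Monotone fun N => birkhoffMax τ f N x := by
  refine monotone_nat_of_le_succ fun N => ?_
  induction N generalizing x with
  | zero => exact birkhoffMax_nonneg 1 x
  | succ N ih => exact max_le_max le_rfl (add_le_add le_rfl (ih (τ x)))

theorem birkhoffSum_le_birkhoffMax (N : ℕ) (x : X) :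
    birkhoffSum τ f N x ≤ birkhoffMax τ f N x := by
  induction N generalizing x with
  | zero => simp [birkhoffMax]
  | succ N ih =>
    rw [birkhoffSum_succ']
    exact (add_le_add le_rfl (ih (τ x))).trans (le_max_right _ _)

/-- The set where the running maxima stay bounded is therefore strictly $\tau$-invariant, and
ergodicity makes it null or of full measure. -/
theorem bddAbove_birkhoffMax_comp_iff (x : X) :
    BddAbove (range fun N => birkhoffMax τ f N (τ x)) ↔
      BddAbove (range fun N => birkhoffMax τ f N x) := by
  constructor
  · rintro ⟨C, hC⟩
    refine ⟨max 0 (f x + C), ?_⟩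
    rintro _ ⟨N, rfl⟩
    cases N with
    | zero => exact le_max_left _ _
    | succ N => exact max_le_max le_rfl (add_le_add le_rfl (hC ⟨N, rfl⟩))
  · rintro ⟨C, hC⟩
    refine ⟨C - f x, ?_⟩
    rintro _ ⟨N, rfl⟩
    have : f x + birkhoffMax τ f N (τ x) ≤ C := (le_max_right _ _).trans (hC ⟨N + 1, rfl⟩)
    simp only
    linarith

variable [MeasurableSpace X] {μ : Measure X}

theorem measurable_birkhoffMax (hτ : Measurable τ) (hf : Measurable f) (N : ℕ) :
    Measurable (birkhoffMax τ f N) := by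
  induction N with
  | zero => exact measurable_const
  | succ N ih => exact measurable_const.max (hf.add (ih.comp hτ))

theorem integrable_birkhoffMax [IsFiniteMeasure μ] (hτ : MeasurePreserving τ μ μ)
    (hf : Integrable f μ) (N : ℕ) : Integrable (birkhoffMax τ f N) μ := by
  induction N with
  | zero => exact integrable_zero _ _ _
  | succ N ih =>
    exact (integrable_const (0 : ℝ)).sup (hf.add (hτ.integrable_comp_of_integrable ih))

theorem integral_comp_measurePreserving {Y : Type*} [MeasurableSpace Y] {ν : Measure Y} {g : X → Y}
    (hg : MeasurePreserving g μ ν) {h : Y → ℝ} (hh : AEStronglyMeasurable h ν) :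
    ∫ x, h (g x) ∂μ = ∫ y, h y ∂ν := by
  rw [← hg.map_eq] at hh ⊢
  exact (integral_map hg.measurable.aemeasurable hh).symm

/-- If `∫ f < 0` then the Birkhoff sums of `f` are almost everywhere bounded above. -/
theorem ae_bddAbove_birkhoffSum [IsFiniteMeasure μ] (hτ : Ergodic τ μ)
    (hfm : Measurable f) (hf : Integrable f μ) (hneg : ∫ x, f x ∂μ < 0) :
    ∀ᵐ x ∂μ, BddAbove (range fun n => birkhoffSum τ f n x) := by
  set E : Set X := {x | BddAbove (range fun N => birkhoffMax τ f N x)} with hE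
  have hEm : MeasurableSet E :=
    measurableSet_bddAbove_range fun N => measurable_birkhoffMax hτ.measurable hfm N
  have hEinv : τ ⁻¹' E = E := by
    ext x
    exact bddAbove_birkhoffMax_comp_iff x
  have hsub : ∀ᵐ x ∂μ, x ∈ E := by
    rcases hτ.toPreErgodic.ae_mem_or_ae_notMem hEm hEinv with h | h
    · exact h
    -- If the maxima $M_N$ diverge almost everywhere, then
    -- $M_{N+1}-M_N\circ\tau=\max(-M_N\circ\tau,f)$ is eventually equal to $f$ and is dominated by
    -- $|f|$. Its integral is $\int M_{N+1}-\int M_N\ge0$ by invariance, so $\int f\ge0$ in the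
    -- limit, a contradiction.
    exfalso
    have hint : ∀ N, Integrable (fun x => birkhoffMax τ f (N + 1) x - birkhoffMax τ f N (τ x)) μ :=
      fun N => (integrable_birkhoffMax hτ.toMeasurePreserving hf (N + 1)).sub
        (hτ.toMeasurePreserving.integrable_comp_of_integrable
          (integrable_birkhoffMax hτ.toMeasurePreserving hf N))
    have heq : ∀ N x, birkhoffMax τ f (N + 1) x - birkhoffMax τ f N (τ x)
        = max (-birkhoffMax τ f N (τ x)) (f x) := by
      intro N x
      simp only [birkhoffMax]
      rw [max_sub_sub_right _ _ _ |>.symm]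
      congr 1 <;> ring
    have hlim : Tendsto (fun N => ∫ x, (birkhoffMax τ f (N + 1) x - birkhoffMax τ f N (τ x)) ∂μ)
        atTop (𝓝 (∫ x, f x ∂μ)) := by
      refine tendsto_integral_of_dominated_convergence (fun x => ‖f x‖)
        (fun N => (hint N).aestronglyMeasurable) hf.norm (fun N => ae_of_all _ fun x => ?_) ?_
      · rw [heq, Real.norm_eq_abs, Real.norm_eq_abs]
        refine abs_le.2 ⟨(neg_abs_le _).trans (le_max_right _ _), max_le ?_ (le_abs_self _)⟩
        exact (neg_nonpos.2 (birkhoffMax_nonneg _ _)).trans (abs_nonneg _)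
      · filter_upwards [h] with x hx
        have hx' : ¬ BddAbove (range fun N => birkhoffMax τ f N (τ x)) := fun hb =>
          hx ((bddAbove_birkhoffMax_comp_iff x).1 hb)
        have ht := tendsto_atTop_of_monotone (birkhoffMax_mono (τ := τ) (f := f) (τ x))
        have hat : Tendsto (fun N => birkhoffMax τ f N (τ x)) atTop atTop := by
          rcases ht with ht | ⟨l, hl⟩
          · exact ht
          · exact absurd hl.bddAbove_range hx'
        refine tendsto_const_nhds.congr' ?_
        filter_upwards [hat.eventually_ge_atTop (-f x)] with N hN
        rw [heq, max_eq_right (by linarith)]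
    refine absurd (ge_of_tendsto' hlim fun N => ?_) (not_le.2 hneg)
    have hI := integrable_birkhoffMax hτ.toMeasurePreserving hf
    have hIN := hτ.toMeasurePreserving.integrable_comp_of_integrable (hI N)
    have hsplit : ∫ x, (birkhoffMax τ f (N + 1) x - birkhoffMax τ f N (τ x)) ∂μ
        = ∫ x, birkhoffMax τ f (N + 1) x ∂μ - ∫ x, birkhoffMax τ f N x ∂μ := by
      rw [← integral_comp_measurePreserving hτ.toMeasurePreserving (hI N).aestronglyMeasurable]
      exact integral_sub (hI (N + 1)) hIN
    rw [hsplit, sub_nonneg]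
    exact integral_mono (hI N) (hI (N + 1)) fun x => birkhoffMax_mono x N.le_succ
  filter_upwards [hsub] with x ⟨C, hC⟩
  refine ⟨C, ?_⟩
  rintro _ ⟨n, rfl⟩
  exact (birkhoffSum_le_birkhoffMax n x).trans (hC ⟨n, rfl⟩)

theorem ae_eventually_birkhoffSum_div_le [IsProbabilityMeasure μ] (hτ : Ergodic τ μ)
    (hfm : Measurable f) (hf : Integrable f μ) {ε : ℝ} (hε : 0 < ε) :
    ∀ᵐ x ∂μ, ∀ᶠ n : ℕ in atTop, birkhoffSum τ f n x / n ≤ ∫ y, f y ∂μ + ε := by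
  -- Half of $\varepsilon$ makes the mean of $f-c$ negative; the other half absorbs the bound on its
  -- Birkhoff sums divided by $n$.
  set c := ∫ y, f y ∂μ + ε / 2 with hc
  have hint : Integrable (fun x => f x - c) μ := hf.sub (integrable_const c)
  have hneg : ∫ x, (f x - c) ∂μ < 0 := by
    rw [integral_sub hf (integrable_const c)]
    simp only [integral_const, probReal_univ, smul_eq_mul, one_mul]
    linarith
  filter_upwards [ae_bddAbove_birkhoffSum hτ (hfm.sub_const c) hint hneg] with x ⟨C, hC⟩
  have hlim : Tendsto (fun n : ℕ => C / (n : ℝ)) atTop (𝓝 0) := tendsto_const_div_atTop_nhds_zero_nat C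
  filter_upwards [hlim.eventually_lt_const (half_pos hε), eventually_gt_atTop 0] with n hn hn0
  have hn' : (0 : ℝ) < n := Nat.cast_pos.2 hn0
  have h1 : birkhoffSum τ (fun x => f x - c) n x ≤ C := hC ⟨n, rfl⟩
  have h2 : birkhoffSum τ (fun x => f x - c) n x = birkhoffSum τ f n x - n * c := by
    simp [birkhoffSum, Finset.sum_sub_distrib]
  rw [h2] at h1
  have h3 : birkhoffSum τ f n x / n ≤ C / n + c := by
    rw [div_add' _ _ _ hn'.ne', div_le_div_iff_of_pos_right hn']
    linarith
  linarith

/-- **Birkhoff's pointwise ergodic theorem** for ergodic maps. -/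
theorem ae_tendsto_birkhoffSum_div [IsProbabilityMeasure μ] (hτ : Ergodic τ μ)
    (hfm : Measurable f) (hf : Integrable f μ) :
    ∀ᵐ x ∂μ, Tendsto (fun n : ℕ => birkhoffSum τ f n x / n) atTop (𝓝 (∫ y, f y ∂μ)) := by
  have hup : ∀ᵐ x ∂μ, ∀ k : ℕ, ∀ᶠ n : ℕ in atTop,
      birkhoffSum τ f n x / n ≤ ∫ y, f y ∂μ + 1 / ((k : ℝ) + 1) :=
    ae_all_iff.2 fun k => ae_eventually_birkhoffSum_div_le hτ hfm hf (by positivity)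
  have hlo : ∀ᵐ x ∂μ, ∀ k : ℕ, ∀ᶠ n : ℕ in atTop,
      birkhoffSum τ (-f) n x / n ≤ ∫ y, (-f) y ∂μ + 1 / ((k : ℝ) + 1) :=
    ae_all_iff.2 fun k => ae_eventually_birkhoffSum_div_le hτ hfm.neg hf.neg (by positivity)
  filter_upwards [hup, hlo] with x h1 h2
  rw [Metric.tendsto_nhds]
  intro ε hε
  obtain ⟨k, hk⟩ := exists_nat_one_div_lt hε
  filter_upwards [h1 k, h2 k] with n hn1 hn2
  rw [birkhoffSum_neg, integral_neg', neg_div] at hn2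
  rw [Real.dist_eq, abs_lt]
  constructor <;> linarith

end Birkhoff

/-! ### Maximal inequality for stationary orthogonal sequences -/

section Orthogonal

variable {X : Type*} {τ : X → X} {f : X → ℝ}

/-- A majorant of the squared Birkhoff sums of `f` up to time `2 ^ k`. -/
noncomputable def orthMax (τ : X → X) (f : X → ℝ) : ℕ → X → ℝ
  | 0, x => f x ^ 2
  | k + 1, x => ((k : ℝ) + 2) * birkhoffSum τ f (2 ^ k) x ^ 2 +
      (1 + 1 / ((k : ℝ) + 1)) * (orthMax τ f k x + orthMax τ f k (τ^[2 ^ k] x))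

theorem orthMax_nonneg (k : ℕ) (x : X) : 0 ≤ orthMax τ f k x := by
  induction k generalizing x with
  | zero => exact sq_nonneg _
  | succ k ih =>
    have := ih x
    have := ih (τ^[2 ^ k] x)
    simp only [orthMax]
    positivity

/-- Dyadic chaining: a sum longer than $2^k$ is a full block of length $2^k$ plus a shorter sum
started at $\tau^{2^k}x$. The two are combined by $2ab\le(k+1)a^2+b^2/(k+1)$; the weight $k+1$ keeps
the product of the factors $1+1/(k+1)$ polynomial in $k$. -/
theorem sq_birkhoffSum_le_orthMax (k N : ℕ) (hN : N ≤ 2 ^ k) (x : X) :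
    birkhoffSum τ f N x ^ 2 ≤ orthMax τ f k x := by
  induction k generalizing N x with
  | zero =>
    rcases Nat.le_one_iff_eq_zero_or_eq_one.1 (by simpa using hN) with rfl | rfl
    · simpa using orthMax_nonneg 0 x
    · simp [orthMax]
  | succ k ih =>
    have hk : (0 : ℝ) < (k : ℝ) + 1 := by positivity
    have h0 := orthMax_nonneg (τ := τ) (f := f) k x
    have h1 := orthMax_nonneg (τ := τ) (f := f) k (τ^[2 ^ k] x)
    have hle : orthMax τ f k x + orthMax τ f k (τ^[2 ^ k] x) ≤
        (1 + 1 / ((k : ℝ) + 1)) * (orthMax τ f k x + orthMax τ f k (τ^[2 ^ k] x)) :=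
      le_mul_of_one_le_left (by positivity) (by simp only [le_add_iff_nonneg_right]; positivity)
    simp only [orthMax]
    rcases le_or_gt N (2 ^ k) with h | h
    · have := ih N h x
      have : 0 ≤ ((k : ℝ) + 2) * birkhoffSum τ f (2 ^ k) x ^ 2 := by positivity
      linarith
    · obtain ⟨N', rfl⟩ := Nat.exists_eq_add_of_lt h
      have hN' : N' + 1 ≤ 2 ^ k := by rw [pow_succ] at hN; omega
      have h2 := ih (N' + 1) hN' (τ^[2 ^ k] x)
      rw [add_assoc, birkhoffSum_add]
      set a := birkhoffSum τ f (2 ^ k) x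
      set b := birkhoffSum τ f (N' + 1) (τ^[2 ^ k] x)
      have h3 : (a + b) ^ 2 ≤ ((k : ℝ) + 2) * a ^ 2 + (1 + 1 / ((k : ℝ) + 1)) * b ^ 2 := by
        have h4 : 0 ≤ (((k : ℝ) + 1) * a - b) ^ 2 / ((k : ℝ) + 1) := by positivity
        have h5 : (((k : ℝ) + 1) * a - b) ^ 2 / ((k : ℝ) + 1)
            = ((k : ℝ) + 1) * a ^ 2 - 2 * a * b + 1 / ((k : ℝ) + 1) * b ^ 2 := by
          field_simp
          ring
        nlinarith
      have h6 : (1 + 1 / ((k : ℝ) + 1)) * b ^ 2 ≤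
          (1 + 1 / ((k : ℝ) + 1)) * (orthMax τ f k x + orthMax τ f k (τ^[2 ^ k] x)) :=
        mul_le_mul_of_nonneg_left (by linarith) (by positivity)
      linarith

variable [MeasurableSpace X] {μ : Measure X}

theorem memLp_birkhoffSum (hτ : MeasurePreserving τ μ μ) (hf : MemLp f 2 μ) (N : ℕ) :
    MemLp (birkhoffSum τ f N) 2 μ := by
  have : birkhoffSum τ f N = fun x => ∑ k ∈ Finset.range N, (f ∘ τ^[k]) x := rfl
  rw [this]
  exact memLp_finsetSum _ fun k _ => hf.comp_measurePreserving (hτ.iterate k)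

theorem integral_sq_birkhoffSum (hτ : MeasurePreserving τ μ μ) (hf : MemLp f 2 μ)
    (horth : ∀ k, ∫ x, f x * f (τ^[k + 1] x) ∂μ = 0) (N : ℕ) :
    ∫ x, birkhoffSum τ f N x ^ 2 ∂μ = N * ∫ x, f x ^ 2 ∂μ := by
  induction N with
  | zero => simp
  | succ N ih =>
    have hS := memLp_birkhoffSum hτ hf N
    have hSτ : MemLp (fun x => birkhoffSum τ f N (τ x)) 2 μ := hS.comp_measurePreserving hτ
    have hcross : ∫ x, f x * birkhoffSum τ f N (τ x) ∂μ = 0 := by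
      simp only [birkhoffSum, Finset.mul_sum, ← Function.iterate_succ_apply]
      have hi : ∀ k : ℕ, Integrable (fun x => f x * f (τ^[k.succ] x)) μ := fun k =>
        hf.integrable_mul (hf.comp_measurePreserving (hτ.iterate (k + 1)))
      rw [integral_finsetSum _ fun k _ => hi k]
      exact Finset.sum_eq_zero fun k _ => horth k
    have hexp : ∀ x, birkhoffSum τ f (N + 1) x ^ 2 =
        f x ^ 2 + (2 * (f x * birkhoffSum τ f N (τ x)) + birkhoffSum τ f N (τ x) ^ 2) := by
      intro x
      rw [birkhoffSum_succ']
      ring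
    have hi : Integrable (fun x => 2 * (f x * birkhoffSum τ f N (τ x))) μ :=
      (hf.integrable_mul hSτ).const_mul 2
    have hi' : Integrable (fun x => 2 * (f x * birkhoffSum τ f N (τ x)) +
        birkhoffSum τ f N (τ x) ^ 2) μ := hi.add hSτ.integrable_sq
    have hstat : ∫ x, birkhoffSum τ f N (τ x) ^ 2 ∂μ = ∫ x, birkhoffSum τ f N x ^ 2 ∂μ :=
      integral_comp_measurePreserving hτ (h := fun x => birkhoffSum τ f N x ^ 2)
        hS.integrable_sq.aestronglyMeasurable
    simp only [hexp]
    rw [integral_add hf.integrable_sq hi', integral_add hi hSτ.integrable_sq,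
      integral_const_mul, hcross, hstat, ih]
    push_cast
    ring

theorem integrable_orthMax (hτ : MeasurePreserving τ μ μ) (hf : MemLp f 2 μ) (k : ℕ) :
    Integrable (orthMax τ f k) μ := by
  induction k with
  | zero => exact hf.integrable_sq
  | succ k ih =>
    exact ((memLp_birkhoffSum hτ hf _).integrable_sq.const_mul _).add
      ((ih.add ((hτ.iterate _).integrable_comp_of_integrable ih)).const_mul _)

/-- Orthogonality makes the second moment of a block linear in its length, so the maximum over times
up to $2^k$ costs only the extra factor $(k+1)^2$. -/
theorem integral_orthMax_le (hτ : MeasurePreserving τ μ μ) (hf : MemLp f 2 μ)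
    (horth : ∀ k, ∫ x, f x * f (τ^[k + 1] x) ∂μ = 0) (k : ℕ) :
    ∫ x, orthMax τ f k x ∂μ ≤ ((k : ℝ) + 1) ^ 2 * 2 ^ k * ∫ x, f x ^ 2 ∂μ := by
  induction k with
  | zero => simp [orthMax]
  | succ k ih =>
    have hQ := integrable_orthMax hτ hf k
    have hQτ : Integrable (fun x => orthMax τ f k (τ^[2 ^ k] x)) μ :=
      (hτ.iterate (2 ^ k)).integrable_comp_of_integrable hQ
    have hQQ : Integrable (fun x => orthMax τ f k x + orthMax τ f k (τ^[2 ^ k] x)) μ := hQ.add hQτ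
    have hc : 0 ≤ ∫ x, f x ^ 2 ∂μ := integral_nonneg fun x => sq_nonneg _
    have heq : ∫ x, orthMax τ f (k + 1) x ∂μ = ((k : ℝ) + 2) * (2 ^ k * ∫ x, f x ^ 2 ∂μ) +
        (1 + 1 / ((k : ℝ) + 1)) * (2 * ∫ x, orthMax τ f k x ∂μ) := by
      have h1 := (memLp_birkhoffSum hτ hf (2 ^ k)).integrable_sq
      have h2 : ∫ x, orthMax τ f k (τ^[2 ^ k] x) ∂μ = ∫ x, orthMax τ f k x ∂μ :=
        integral_comp_measurePreserving (hτ.iterate (2 ^ k)) hQ.aestronglyMeasurable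
      simp only [orthMax]
      rw [integral_add (h1.const_mul _) (hQQ.const_mul _), integral_const_mul,
        integral_const_mul, integral_sq_birkhoffSum hτ hf horth]
      have h3 : ∫ x, (orthMax τ f k x + orthMax τ f k (τ^[2 ^ k] x)) ∂μ
          = 2 * ∫ x, orthMax τ f k x ∂μ := by
        rw [integral_add hQ hQτ, h2, two_mul]
      rw [h3]
      push_cast
      ring
    have hk : (0 : ℝ) < (k : ℝ) + 1 := by positivity
    rw [heq]
    have h4 : (1 + 1 / ((k : ℝ) + 1)) * (2 * ∫ x, orthMax τ f k x ∂μ) ≤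
        (1 + 1 / ((k : ℝ) + 1)) * (2 * (((k : ℝ) + 1) ^ 2 * 2 ^ k * ∫ x, f x ^ 2 ∂μ)) := by
      gcongr
    have h5 : (1 + 1 / ((k : ℝ) + 1)) * (2 * (((k : ℝ) + 1) ^ 2 * 2 ^ k * ∫ x, f x ^ 2 ∂μ))
        = ((k : ℝ) + 2) * (((k : ℝ) + 1) * 2) * (2 ^ k * ∫ x, f x ^ 2 ∂μ) := by
      field_simp
      ring
    have h6 : 0 ≤ 2 ^ k * ∫ x, f x ^ 2 ∂μ := by positivity
    push_cast
    rw [pow_succ (2 : ℝ) k]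
    nlinarith

theorem ae_summable_of_summable_integral {F : ℕ → X → ℝ} (hF : ∀ k, Integrable (F k) μ)
    (hF0 : ∀ k x, 0 ≤ F k x) (hsum : Summable fun k => ∫ x, F k x ∂μ) :
    ∀ᵐ x ∂μ, Summable fun k => F k x := by
  have h1 : ∫⁻ x, ∑' k, ENNReal.ofReal (F k x) ∂μ ≠ ∞ := by
    rw [lintegral_tsum fun k => (hF k).aestronglyMeasurable.aemeasurable.ennreal_ofReal]
    simp_rw [← fun k => ofReal_integral_eq_lintegral_ofReal (hF k) (ae_of_all _ (hF0 k))]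
    exact hsum.tsum_ofReal_ne_top
  have h2 := ae_lt_top' (AEMeasurable.tsum fun k =>
    (hF k).aestronglyMeasurable.aemeasurable.ennreal_ofReal) h1
  filter_upwards [h2] with x hx
  have h3 := ENNReal.summable_toReal hx.ne
  simpa [ENNReal.toReal_ofReal (hF0 _ x)] using h3

/-- The ergodic theorem for $|g|^q$ gives $g\circ\tau^N=o(N^{1/q})$, and the maximal inequality
bounds the Birkhoff sums by nearly $N^{1/2}$; since $1/q+1/2<1$, the product is $o(N)$. -/
theorem ae_tendsto_mul_birkhoffSum_div [IsProbabilityMeasure μ] (hτ : Ergodic τ μ)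
    (hf : MemLp f 2 μ) (horth : ∀ k, ∫ x, f x * f (τ^[k + 1] x) ∂μ = 0)
    {g : X → ℝ} (hg : Measurable g) {q : ℝ} (hq : 2 < q)
    (hgq : Integrable (fun x => |g x| ^ q) μ) :
    ∀ᵐ x ∂μ, Tendsto (fun N : ℕ => g (τ^[N] x) * birkhoffSum τ f N x / N) atTop (𝓝 0) := by
  -- For $N\approx2^k$, $r^k$ is the size of $N^{2/q}/N^2$. As the majorant has mean at most of
  -- order $k^22^k$, summability requires $2r<1$, which is exactly $q>2$.
  set r : ℝ := 2 ^ (2 / q) / 4 with hr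
  have hr0 : 0 < r := by positivity
  have hr1 : 2 * r < 1 := by
    have : (2 : ℝ) ^ (2 / q) < 2 ^ (1 : ℝ) :=
      Real.rpow_lt_rpow_of_exponent_lt one_lt_two ((div_lt_one (by linarith)).2 hq)
    rw [Real.rpow_one] at this
    rw [hr]
    linarith
  -- The $N$-th summand is the difference of consecutive Birkhoff sums, whose averages have the same
  -- limit.
  have hgrowth : ∀ᵐ x ∂μ, Tendsto (fun N : ℕ => |g (τ^[N] x)| ^ q / N) atTop (𝓝 0) := by
    filter_upwards [ae_tendsto_birkhoffSum_div hτ (hg.abs.pow_const q) hgq] with x hx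
    have h1 := hx.comp (tendsto_add_atTop_nat 1)
    have h2 : Tendsto (fun N : ℕ => ((N + 1 : ℕ) : ℝ) / N) atTop (𝓝 1) := by
      simpa using tendsto_natCast_div_add_atTop (1 : ℝ) |>.inv₀ one_ne_zero
    have h3 := (h1.mul h2).sub hx
    rw [mul_one, sub_self] at h3
    refine h3.congr' ?_
    filter_upwards [eventually_gt_atTop 0] with N hN
    have : (0 : ℝ) < N := Nat.cast_pos.2 hN
    simp only [Function.comp_apply, birkhoffSum_succ]
    push_cast
    field_simp
    ring
  have hmax : ∀ᵐ x ∂μ, Summable fun k => orthMax τ f k x * r ^ k := by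
    refine ae_summable_of_summable_integral
      (fun k => (integrable_orthMax hτ.toMeasurePreserving hf k).mul_const _)
      (fun k x => mul_nonneg (orthMax_nonneg k x) (by positivity)) ?_
    have hgeo : Summable fun k : ℕ => (((k : ℝ) + 1) ^ 2 * (2 * r) ^ k) * ∫ x, f x ^ 2 ∂μ := by
      refine Summable.mul_right _ ?_
      have h0 : ‖2 * r‖ < 1 := by rwa [Real.norm_of_nonneg (by positivity)]
      have h2 := summable_pow_mul_geometric_of_norm_lt_one 2 h0
      have h1 := (summable_pow_mul_geometric_of_norm_lt_one 1 h0).mul_left 2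
      have h3 := summable_pow_mul_geometric_of_norm_lt_one 0 h0
      refine ((h2.add h1).add h3).congr fun k => ?_
      ring
    refine Summable.of_nonneg_of_le (fun k => integral_nonneg fun x =>
      mul_nonneg (orthMax_nonneg k x) (by positivity)) (fun k => ?_) hgeo
    rw [integral_mul_const, mul_pow]
    have := mul_le_mul_of_nonneg_right
      (integral_orthMax_le hτ.toMeasurePreserving hf horth k) (pow_nonneg hr0.le k)
    linarith
  filter_upwards [hgrowth, hmax] with x h1 h2
  have h3 : Tendsto (fun N : ℕ => 4 * (orthMax τ f (Nat.log 2 N + 1) x * r ^ (Nat.log 2 N + 1)))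
      atTop (𝓝 0) := by
    have hlog : Tendsto (fun N : ℕ => Nat.log 2 N + 1) atTop atTop := by
      refine tendsto_atTop_mono (fun N => Nat.le_succ _) ?_
      refine tendsto_atTop_atTop.2 fun b => ⟨2 ^ b, fun N hN => ?_⟩
      exact Nat.le_log_of_pow_le one_lt_two hN
    simpa using (h2.tendsto_atTop_zero.comp hlog).const_mul 4
  have h4 : Tendsto (fun N : ℕ => (g (τ^[N] x) * birkhoffSum τ f N x / N) ^ 2) atTop (𝓝 0) := by
    refine squeeze_zero' (Eventually.of_forall fun N => sq_nonneg _) ?_ h3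
    filter_upwards [h1.eventually_lt_const one_pos, eventually_gt_atTop 0] with N hN hN0
    have hN' : (0 : ℝ) < N := Nat.cast_pos.2 hN0
    -- With $2^k\le N<2^{k+1}$ and $|g(\tau^Nx)|^q\le N$, the square is at most
    -- $2^{(2/q)(k+1)}Q_{k+1}/4^k=4\,r^{k+1}Q_{k+1}$, where $Q$ is the dyadic majorant.
    set k := Nat.log 2 N
    have hkN : (N : ℝ) ≤ 2 ^ (k + 1) := by
      exact_mod_cast (Nat.lt_pow_succ_log_self one_lt_two N).le
    have hNk : (2 : ℝ) ^ k ≤ N := by exact_mod_cast Nat.pow_log_le_self 2 hN0.ne'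
    have hS : birkhoffSum τ f N x ^ 2 ≤ orthMax τ f (k + 1) x :=
      sq_birkhoffSum_le_orthMax (k + 1) N (Nat.lt_pow_succ_log_self one_lt_two N).le x
    have hG : g (τ^[N] x) ^ 2 ≤ (2 ^ (2 / q)) ^ (k + 1) := by
      rw [div_lt_one hN'] at hN
      have hq0 : 0 < q := by linarith
      have e1 : g (τ^[N] x) ^ 2 = (|g (τ^[N] x)| ^ q) ^ (2 / q) := by
        rw [← Real.rpow_mul (abs_nonneg _), mul_div_cancel₀ _ hq0.ne', Real.rpow_two, sq_abs]
      rw [e1, ← Real.rpow_natCast, ← Real.rpow_mul two_pos.le, mul_comm, Real.rpow_mul two_pos.le,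
        Real.rpow_natCast]
      exact Real.rpow_le_rpow (by positivity) (hN.le.trans hkN) (by positivity)
    have hden : (4 : ℝ) ^ (k + 1) ≤ 4 * (N : ℝ) ^ 2 := by
      have : (4 : ℝ) ^ k = (2 ^ k) ^ 2 := by rw [← pow_mul, mul_comm, pow_mul]; norm_num
      rw [pow_succ, this, mul_comm]
      gcongr
    rw [div_pow, mul_pow, div_le_iff₀ (by positivity), hr, div_pow]
    have hQ0 := orthMax_nonneg (τ := τ) (f := f) (k + 1) x
    calc g (τ^[N] x) ^ 2 * birkhoffSum τ f N x ^ 2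
        ≤ (2 ^ (2 / q)) ^ (k + 1) * orthMax τ f (k + 1) x := by gcongr
      _ = (2 ^ (2 / q)) ^ (k + 1) * orthMax τ f (k + 1) x / 4 ^ (k + 1) * 4 ^ (k + 1) := by
          field_simp
      _ ≤ (2 ^ (2 / q)) ^ (k + 1) * orthMax τ f (k + 1) x / 4 ^ (k + 1) * (4 * (N : ℝ) ^ 2) := by
          gcongr
      _ = _ := by ring
  have h5 := h4.sqrt
  simp only [Real.sqrt_sq_eq_abs, Real.sqrt_zero] at h5
  exact (tendsto_zero_iff_abs_tendsto_zero _).2 h5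

end Orthogonal

/-! ### Iterated sums and coboundaries -/

section PairSum

variable {X : Type*} {τ : X → X}

/-- `∑_{i < j < N} a (τ^i x) b (τ^j x)`. -/
noncomputable def pairSum (τ : X → X) (a b : X → ℝ) (x : X) (N : ℕ) : ℝ :=
  ∑ j ∈ Finset.range N, ∑ i ∈ Finset.range j, a (τ^[i] x) * b (τ^[j] x)

theorem pairSum_succ (a b : X → ℝ) (x : X) (N : ℕ) :
    pairSum τ a b x (N + 1) = pairSum τ a b x N + birkhoffSum τ a N x * b (τ^[N] x) := by
  rw [pairSum, Finset.sum_range_succ, birkhoffSum, Finset.sum_mul, pairSum]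

/-- The function `v + χ - χ ∘ τ`, cohomologous to `v`. -/
def cohomologous (τ : X → X) (v χ : X → ℝ) (x : X) : ℝ := v x + χ x - χ (τ x)

theorem birkhoffSum_cohomologous (v χ : X → ℝ) (x : X) (N : ℕ) :
    birkhoffSum τ (cohomologous τ v χ) N x = birkhoffSum τ v N x + χ x - χ (τ^[N] x) := by
  induction N with
  | zero => simp
  | succ N ih =>
    rw [birkhoffSum_succ, ih, birkhoffSum_succ, cohomologous, Function.iterate_succ_apply']
    ring

theorem pairSum_sub_pairSum_cohomologous (a α b β : X → ℝ) (x : X) (N : ℕ) :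
    pairSum τ a b x N - pairSum τ (cohomologous τ a α) (cohomologous τ b β) x N =
      birkhoffSum τ (fun y => α y * b y - cohomologous τ a α y * β (τ y)) N x -
        α x * birkhoffSum τ b N x + β (τ^[N] x) * birkhoffSum τ (cohomologous τ a α) N x := by
  induction N with
  | zero => simp [pairSum]
  | succ N ih =>
    have h := birkhoffSum_cohomologous (τ := τ) a α x N
    rw [pairSum_succ, pairSum_succ, birkhoffSum_succ, birkhoffSum_succ, birkhoffSum_succ,
      Function.iterate_succ_apply']
    have hb : b (τ^[N] x) = cohomologous τ b β (τ^[N] x) - β (τ^[N] x) + β (τ (τ^[N] x)) := by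
      rw [cohomologous]; ring
    linear_combination ih - b (τ^[N] x) * h +
      birkhoffSum τ (cohomologous τ a α) N x * hb

variable [MeasurableSpace X] {μ : Measure X}

/-- In `L²(μ)`, `χ = ∑_{n ≥ 1} (U*)^n v` weakly, where `U f = f ∘ τ`. -/
def IsDualSum (μ : Measure X) (τ : X → X) (v χ : X → ℝ) : Prop :=
  ∀ f : X → ℝ, Measurable f → MemLp f 2 μ →
    HasSum (fun n : ℕ => ∫ x, v x * f (τ^[n + 1] x) ∂μ) (∫ x, χ x * f x ∂μ)

variable {v χ : X → ℝ}

theorem memLp_cohomologous (hτ : MeasurePreserving τ μ μ) (hv : MemLp v 2 μ) (hχ : MemLp χ 2 μ) :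
    MemLp (cohomologous τ v χ) 2 μ :=
  (hv.add hχ).sub (hχ.comp_measurePreserving hτ)

/-- This is $U^*m=0$. Testing the dual series against $f\circ\tau$ shifts it by one, so it loses its
first term $\int v\,(f\circ\tau)$; this cancels against the term $v$ of $m$. -/
theorem integral_cohomologous_mul (hτ : MeasurePreserving τ μ μ) (hv : MemLp v 2 μ)
    (hχ : MemLp χ 2 μ) (h : IsDualSum μ τ v χ) {f : X → ℝ} (hfm : Measurable f)
    (hf : MemLp f 2 μ) : ∫ x, cohomologous τ v χ x * f (τ x) ∂μ = 0 := by
  have hfτ : MemLp (fun x => f (τ x)) 2 μ := hf.comp_measurePreserving hτ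
  have h1 : HasSum (fun n : ℕ => ∫ x, v x * f (τ^[n + 1 + 1] x) ∂μ) (∫ x, χ x * f (τ x) ∂μ) := by
    simpa only [Function.iterate_succ_apply' τ (_ + 1)] using
      h (fun x => f (τ x)) (hfm.comp hτ.measurable) hfτ
  have h2 := (hasSum_nat_add_iff' 1).2 (h f hfm hf)
  have h3 := h1.unique h2
  have h4 : ∫ x, χ (τ x) * f (τ x) ∂μ = ∫ x, χ x * f x ∂μ :=
    integral_comp_measurePreserving hτ (h := fun x => χ x * f x)
      (hχ.integrable_mul hf).aestronglyMeasurable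
  have hi1 : Integrable (fun x => v x * f (τ x)) μ := hv.integrable_mul hfτ
  have hi2 : Integrable (fun x => χ x * f (τ x)) μ := hχ.integrable_mul hfτ
  have hi3 : Integrable (fun x => χ (τ x) * f (τ x)) μ :=
    (hχ.comp_measurePreserving hτ).integrable_mul hfτ
  have h5 : ∀ x, cohomologous τ v χ x * f (τ x) =
      v x * f (τ x) + χ x * f (τ x) - χ (τ x) * f (τ x) := fun x => by
    rw [cohomologous]; ring
  have hi12 : Integrable (fun x => v x * f (τ x) + χ x * f (τ x)) μ := hi1.add hi2
  simp only [h5]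
  rw [integral_sub hi12 hi3, integral_add hi1 hi2, h3, h4]
  simp

theorem integral_cohomologous_mul_iterate (hτ : MeasurePreserving τ μ μ) (hv : MemLp v 2 μ)
    (hχ : MemLp χ 2 μ) (h : IsDualSum μ τ v χ) {f : X → ℝ} (hfm : Measurable f)
    (hf : MemLp f 2 μ) (k : ℕ) : ∫ x, cohomologous τ v χ x * f (τ^[k + 1] x) ∂μ = 0 := by
  simpa only [Function.iterate_succ_apply] using
    integral_cohomologous_mul hτ hv hχ h (f := fun x => f (τ^[k] x))
      (hfm.comp (hτ.iterate k).measurable) (hf.comp_measurePreserving (hτ.iterate k))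

/-- Tested against $f=1$, the convergent dual series has constant terms $\int v$. -/
theorem integral_eq_zero_of_isDualSum [IsFiniteMeasure μ] (h : IsDualSum μ τ v χ) :
    ∫ x, v x ∂μ = 0 := by
  have h1 := (h (fun _ => 1) measurable_const (memLp_const 1)).summable.tendsto_atTop_zero
  simp only [mul_one] at h1
  exact tendsto_nhds_unique tendsto_const_nhds h1

variable {a α b β : X → ℝ}

/-- Orthogonality removes the terms of the cohomologous functions, and what remains is the dual
series of $a$ tested against $b$. -/
theorem tendsto_sum_integral_lag (hτ : MeasurePreserving τ μ μ)
    (hα : MemLp α 2 μ) (hb : MemLp b 2 μ) (hbm : Measurable b) (ha : MemLp a 2 μ)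
    (hβm : Measurable β) (hβ : MemLp β 2 μ) (hτm : Measurable τ) (h : IsDualSum μ τ a α) :
    Tendsto (fun n : ℕ => ∑ j ∈ Finset.Icc 1 n, ∫ x, (a x * b (τ^[j] x) -
      cohomologous τ a α x * cohomologous τ b β (τ^[j] x)) ∂μ) atTop
      (𝓝 (∫ x, α x * b x ∂μ)) := by
  have hmb : MemLp (cohomologous τ b β) 2 μ := memLp_cohomologous hτ hb hβ
  have hmbm : Measurable (cohomologous τ b β) := (hbm.add hβm).sub (hβm.comp hτm)
  have h1 : ∀ j : ℕ, ∫ x, (a x * b (τ^[j + 1] x) -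
      cohomologous τ a α x * cohomologous τ b β (τ^[j + 1] x)) ∂μ =
      ∫ x, a x * b (τ^[j + 1] x) ∂μ := fun j => by
    have hi1 : Integrable (fun x => a x * b (τ^[j + 1] x)) μ :=
      ha.integrable_mul (hb.comp_measurePreserving (hτ.iterate (j + 1)))
    have hi2 : Integrable (fun x => cohomologous τ a α x * cohomologous τ b β (τ^[j + 1] x)) μ :=
      (memLp_cohomologous hτ ha hα).integrable_mul (hmb.comp_measurePreserving (hτ.iterate (j + 1)))
    rw [integral_sub hi1 hi2, integral_cohomologous_mul_iterate hτ ha hα h hmbm hmb, sub_zero]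
  refine (h b hbm hb).tendsto_sum_nat.congr fun n => ?_
  rw [Finset.range_eq_Ico, Finset.sum_Ico_add' (fun j => ∫ x, a x * b (τ^[j] x) ∂μ) 0 n 1]
  refine (Finset.sum_congr (by ext; simp) fun j hj => ?_)
  obtain ⟨i, rfl⟩ := Nat.exists_eq_add_of_le' (Finset.mem_Icc.1 hj).1
  exact (h1 i).symm

theorem ae_tendsto_pairSum_sub_div [IsProbabilityMeasure μ] (hτ : Ergodic τ μ)
    (ham : Measurable a) (hαm : Measurable α) (hbm : Measurable b) (hβm : Measurable β)
    (ha : MemLp a 2 μ) (hα : MemLp α 2 μ) (hb : MemLp b 2 μ) (hβ : MemLp β 2 μ)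
    {q : ℝ} (hq : 2 < q) (hβq : Integrable (fun x => |β x| ^ q) μ)
    (hda : IsDualSum μ τ a α) (hdb : IsDualSum μ τ b β) :
    ∀ᵐ x ∂μ, Tendsto (fun N : ℕ => (pairSum τ a b x N -
      pairSum τ (cohomologous τ a α) (cohomologous τ b β) x N) / N) atTop
      (𝓝 (∫ x, α x * b x ∂μ)) := by
  have hmp := hτ.toMeasurePreserving
  have hm := memLp_cohomologous hmp ha hα
  have hmm : Measurable (cohomologous τ a α) := (ham.add hαm).sub (hαm.comp hτ.measurable)
  have hi1 : Integrable (fun y => α y * b y) μ := hα.integrable_mul hb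
  have hi2 : Integrable (fun y => cohomologous τ a α y * β (τ y)) μ :=
    hm.integrable_mul (hβ.comp_measurePreserving hmp)
  have hint : ∫ y, (α y * b y - cohomologous τ a α y * β (τ y)) ∂μ = ∫ x, α x * b x ∂μ := by
    rw [integral_sub hi1 hi2, integral_cohomologous_mul hmp ha hα hda hβm hβ, sub_zero]
  filter_upwards [ae_tendsto_birkhoffSum_div hτ
      ((hαm.mul hbm).sub (hmm.mul (hβm.comp hτ.measurable))) (hi1.sub hi2),
    ae_tendsto_birkhoffSum_div hτ hbm (hb.integrable one_le_two),
    ae_tendsto_mul_birkhoffSum_div hτ hm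
      (fun k => integral_cohomologous_mul_iterate hmp ha hα hda hmm hm k) hβm hq hβq]
    with x h1 h2 h3
  rw [integral_eq_zero_of_isDualSum hdb] at h2
  have h4 := (h1.sub (h2.const_mul (α x))).add h3
  simp only [Pi.sub_apply, Pi.mul_apply, Function.comp_apply, mul_zero, sub_zero, add_zero] at h4
  rw [hint] at h4
  refine h4.congr fun N => ?_
  rw [pairSum_sub_pairSum_cohomologous, add_div, sub_div, mul_div_assoc (α x)]
  rfl

end PairSum

/-- If `a N / N → S` then `a ⌊n t⌋ / n → t S` uniformly for `t` in compact sets. -/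
theorem tendstoUniformlyOn_floor {a : ℕ → ℝ} {S : ℝ}
    (h : Tendsto (fun N : ℕ => a N / N) atTop (𝓝 S)) {C : Set ℝ≥0} (hC : IsCompact C) :
    TendstoUniformlyOn (fun (n : ℕ) (t : ℝ≥0) => (1 / (n : ℝ)) * a ⌊(n : ℝ≥0) * t⌋₊)
      (fun t => (t : ℝ) * S) atTop C := by
  obtain ⟨R, hR⟩ := hC.bddAbove
  rw [Metric.tendstoUniformlyOn_iff]
  intro ε hε
  -- For $N\le nt\le nR$ the error $N\delta$ is then at most $n\varepsilon/2$; $R+1$ avoids division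
  -- by zero. The finitely many small $N$ are covered by the constant $B$ below.
  set δ : ℝ := ε / (2 * (R + 1)) with hδ
  have hR0 : (0 : ℝ) ≤ R := R.2
  have hδ0 : 0 < δ := by positivity
  obtain ⟨N₀, hN₀⟩ := Metric.tendsto_atTop.1 h δ hδ0
  -- `|a N - N S| ≤ N δ + B` for all `N`
  set B : ℝ := ∑ N ∈ Finset.range (N₀ + 1), |a N - N * S| with hB
  have hbd : ∀ N : ℕ, |a N - N * S| ≤ N * δ + B := by
    intro N
    have hB0 : 0 ≤ B := Finset.sum_nonneg fun _ _ => abs_nonneg _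
    rcases le_or_gt N N₀ with hN | hN
    · have : |a N - N * S| ≤ B := Finset.single_le_sum (f := fun N : ℕ => |a N - N * S|)
        (fun _ _ => abs_nonneg _) (Finset.mem_range.2 (Nat.lt_succ_of_le hN))
      have : 0 ≤ (N : ℝ) * δ := by positivity
      linarith
    · have hN' : (0 : ℝ) < N := Nat.cast_pos.2 (by omega)
      have h1 := (hN₀ N hN.le).le
      have h2 : a N - N * S = N * (a N / N - S) := by field_simp
      rw [Real.dist_eq] at h1
      rw [h2, abs_mul, abs_of_pos hN']
      have := mul_le_mul_of_nonneg_left h1 hN'.le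
      linarith
  have hlim : Tendsto (fun n : ℕ => (B + |S|) / (n : ℝ)) atTop (𝓝 0) :=
    tendsto_const_div_atTop_nhds_zero_nat _
  filter_upwards [hlim.eventually_lt_const (half_pos hε), eventually_gt_atTop 0] with n hn hn0 t ht
  have hn' : (0 : ℝ) < n := Nat.cast_pos.2 hn0
  have htR : (t : ℝ) ≤ R := hR ht
  have ht0 : (0 : ℝ) ≤ t := t.2
  set N := ⌊(n : ℝ≥0) * t⌋₊
  have hNle : (N : ℝ) ≤ n * t := by exact_mod_cast Nat.floor_le (zero_le (a := (n : ℝ≥0) * t))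
  have hNlt : (n : ℝ) * t < N + 1 := by exact_mod_cast Nat.lt_floor_add_one ((n : ℝ≥0) * t)
  -- The error splits into the approximation error at $N=\lfloor nt\rfloor$ and the rounding error,
  -- with $0\le nt-N<1$.
  have h1 : (t : ℝ) * S - 1 / n * a N = -(1 / n) * (a N - N * S) + (n * t - N) / n * S := by
    field_simp
    ring
  have h2 : |(n * t - N) / n * S| ≤ |S| / n := by
    rw [abs_mul, abs_div, abs_of_pos hn', div_mul_eq_mul_div]
    gcongr
    exact mul_le_of_le_one_left (abs_nonneg _) (abs_le.2 ⟨by linarith, by linarith⟩)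
  have h3 : |-(1 / (n : ℝ)) * (a N - N * S)| ≤ (N * δ + B) / n := by
    rw [abs_mul, abs_neg, abs_of_pos (by positivity : 0 < 1 / (n : ℝ)), div_mul_eq_mul_div, one_mul]
    gcongr
    exact hbd N
  have h4 : (N * δ + B) / n ≤ ε / 2 + B / n := by
    rw [add_div]
    refine add_le_add ?_ le_rfl
    rw [div_le_iff₀ hn']
    calc (N : ℝ) * δ ≤ n * (R + 1) * δ := by
          gcongr
          exact hNle.trans (by gcongr; linarith)
      _ = ε / 2 * n := by rw [hδ]; field_simp
  rw [Real.dist_eq, h1]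
  rw [add_div] at hn
  linarith [abs_add_le (-(1 / (n : ℝ)) * (a N - N * S)) ((n * t - N) / n * S)]

/-! ### Weak convergence in the Skorokhod space -/

section Skorokhod

open scoped Uniformity

theorem hasBasis_uniformity_skorokhod : (𝓤 Skorokhod).HasBasis
    (fun p : ℝ × ℝ => 0 < p.1 ∧ 0 < p.2) fun p => skorokhodEntourage p.1 p.2 := by
  refine ⟨fun U => ?_⟩
  have h : U ∈ 𝓤 Skorokhod ↔ U ∈ skorokhodBasis.filter := Iff.rfl
  rw [h, FilterBasis.mem_filter_iff]
  constructor
  · rintro ⟨_, ⟨T, ε, hT, hε, rfl⟩, hU⟩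
    exact ⟨(T, ε), ⟨hT, hε⟩, hU⟩
  · rintro ⟨⟨T, ε⟩, ⟨hT, hε⟩, hU⟩
    exact ⟨_, ⟨T, ε, hT, hε, rfl⟩, hU⟩

/-- Countable generation makes the uniformity pseudometrizable, so that weak convergence can be
tested on Lipschitz functions. -/
instance : (𝓤 Skorokhod).IsCountablyGenerated := by
  have h : (𝓤 Skorokhod).HasBasis (fun _ : ℕ => True)
      fun k => skorokhodEntourage ((k : ℝ) + 1) (1 / ((k : ℝ) + 1)) := by
    refine hasBasis_uniformity_skorokhod.to_hasBasis ?_ ?_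
    · rintro ⟨T, ε⟩ ⟨_, hε⟩
      obtain ⟨k, hk⟩ := exists_nat_one_div_lt hε
      obtain ⟨l, hl⟩ := exists_nat_gt T
      refine ⟨max k l, trivial, skorokhodEntourage_mono ?_ ?_⟩
      · have : (l : ℝ) ≤ (max k l : ℕ) := Nat.cast_le.2 (le_max_right _ _)
        simp only
        linarith
      · refine le_trans (one_div_le_one_div_of_le (by positivity) ?_) hk.le
        have : (k : ℝ) ≤ (max k l : ℕ) := Nat.cast_le.2 (le_max_left _ _)
        linarith
    · exact fun k _ => ⟨((k : ℝ) + 1, 1 / ((k : ℝ) + 1)), ⟨by positivity, by positivity⟩, le_rfl⟩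
  exact HasCountableBasis.isCountablyGenerated ⟨h, to_countable _⟩

/-- Paths that become uniformly close on compact sets become close in the Skorokhod space. -/
theorem tendsto_uniformity_skorokhod {ι : Type*} {l : Filter ι} {X Y : ι → Skorokhod}
    (h : ∀ R : ℝ≥0, TendstoUniformlyOn (fun n t => (X n).1 t - (Y n).1 t) 0 l (Iic R)) :
    Tendsto (fun n => (X n, Y n)) l (𝓤 Skorokhod) := by
  rw [hasBasis_uniformity_skorokhod.tendsto_right_iff]
  rintro ⟨T, ε⟩ ⟨hT, hε⟩
  filter_upwards [Metric.tendstoUniformlyOn_iff.1 (h T.toNNReal) ε hε] with n hn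
  refine ⟨OrderIso.refl _, fun t ht => ⟨by simpa using hε, ?_⟩⟩
  have := hn t (NNReal.le_toNNReal_of_coe_le ht)
  simpa [Real.dist_eq, abs_sub_comm] using this

/-- The path `t ↦ g ⌊n t⌋ / n - t c`. -/
noncomputable def stepPath (n : ℕ) (c : ℝ) (g : ℕ → ℝ) : Skorokhod :=
  ⟨fun t => (1 / (n : ℝ)) * g ⌊(n : ℝ≥0) * t⌋₊ - (t : ℝ) * c, by
    intro t
    have hcont : Tendsto (fun s : ℝ≥0 => (s : ℝ) * c) (𝓝 t) (𝓝 ((t : ℝ) * c)) :=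
      (NNReal.continuous_coe.mul continuous_const).tendsto t
    obtain ⟨h1, l, h2⟩ := isCadlag_floor (fun N => (1 / (n : ℝ)) * g N) n t
    exact ⟨Tendsto.sub h1 (hcont.mono_left nhdsWithin_le_nhds), l - t * c,
      h2.sub (hcont.mono_left nhdsWithin_le_nhds)⟩⟩

/-- On $[0,R]$ the path depends on finitely many coordinates of $g$. Continuity from $\mathbb
R^{\mathbb N}$ gives Borel measurability of the random paths without describing the Borel
$\sigma$-algebra of the Skorokhod space. -/
theorem continuous_stepPath (n : ℕ) (c : ℝ) : Continuous (stepPath n c) := by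
  rw [continuous_iff_continuousAt]
  intro g
  rw [ContinuousAt, Uniform.tendsto_nhds_right]
  refine tendsto_uniformity_skorokhod fun R => ?_
  rw [Metric.tendstoUniformlyOn_iff]
  intro ε hε
  have h : ∀ N ∈ Iic ⌊(n : ℝ≥0) * R⌋₊, ∀ᶠ g' : ℕ → ℝ in 𝓝 g,
      |(1 / (n : ℝ)) * g N - (1 / (n : ℝ)) * g' N| < ε := by
    intro N _
    have hc : Tendsto (fun g' : ℕ → ℝ => |(1 / (n : ℝ)) * g N - (1 / (n : ℝ)) * g' N|) (𝓝 g)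
        (𝓝 |(1 / (n : ℝ)) * g N - (1 / (n : ℝ)) * g N|) :=
      Continuous.tendsto (by fun_prop) g
    refine hc.eventually_lt_const ?_
    simpa using hε
  filter_upwards [(finite_Iic _).eventually_all.2 h] with g' hg' t ht
  have hN : ⌊(n : ℝ≥0) * t⌋₊ ≤ ⌊(n : ℝ≥0) * R⌋₊ := Nat.floor_mono (by gcongr; exact ht)
  have := hg' _ hN
  rw [Pi.zero_apply, dist_zero_left, Real.norm_eq_abs]
  simpa only [stepPath, sub_sub_sub_cancel_right] using this

end Skorokhod

section Distribution

variable {Ω Ω' E : Type*} [MeasurableSpace Ω] [MeasurableSpace Ω'] {μ : Measure Ω}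
  [IsProbabilityMeasure μ] {ν : Measure Ω'} [IsProbabilityMeasure ν]

open scoped Uniformity

/-- Two sequences of random variables that almost surely become close have the same limits in
distribution. -/
theorem tendstoInDistribution_of_ae_tendsto_uniformity [UniformSpace E]
    [(𝓤 E).IsCountablyGenerated] [MeasurableSpace E] [BorelSpace E] {X Y : ℕ → Ω → E} {Z : Ω' → E}
    (hX : TendstoInDistribution X atTop Z (fun _ => μ) ν) (hY : ∀ n, AEMeasurable (Y n) μ)
    (h : ∀ᵐ ω ∂μ, Tendsto (fun n => (X n ω, Y n ω)) atTop (𝓤 E)) :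
    TendstoInDistribution Y atTop Z (fun _ => μ) ν := by
  -- A bounded Lipschitz test function is uniformly continuous, so its values along the two
  -- sequences become close almost surely, and dominated convergence applies. No separability or
  -- tightness is needed.
  obtain ⟨_, rfl⟩ := UniformSpace.metrizable_uniformity E
  refine ⟨hY, hX.aemeasurable_limit, tendsto_iff_forall_lipschitz_integral_tendsto.2 ?_⟩
  rintro F ⟨C, hC⟩ ⟨L, hL⟩
  have h1 := tendsto_iff_forall_lipschitz_integral_tendsto.1 hX.tendsto F ⟨C, hC⟩ ⟨L, hL⟩
  have hF : StronglyMeasurable F := hL.continuous.measurable.stronglyMeasurable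
  have hint : ∀ {W : Ω → E}, AEMeasurable W μ → Integrable (fun ω => F (W ω)) μ := by
    intro W hW
    obtain ⟨ω₀⟩ : Nonempty Ω := nonempty_of_isProbabilityMeasure μ
    refine Integrable.of_bound (hF.measurable.comp_aemeasurable hW).aestronglyMeasurable
      (|F (W ω₀)| + C) (ae_of_all _ fun ω => ?_)
    have := hC (W ω) (W ω₀)
    rw [Real.dist_eq] at this
    rw [Real.norm_eq_abs]
    linarith [abs_sub_abs_le_abs_sub (F (W ω)) (F (W ω₀))]
  have hmap : ∀ {W : Ω → E}, AEMeasurable W μ → ∫ x, F x ∂(μ.map W) = ∫ ω, F (W ω) ∂μ :=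
    fun hW => integral_map hW hF.aestronglyMeasurable
  have h2 : Tendsto (fun n => ∫ ω, (F (Y n ω) - F (X n ω)) ∂μ) atTop (𝓝 (∫ _, (0 : ℝ) ∂μ)) := by
    refine tendsto_integral_of_dominated_convergence (fun _ => C)
      (fun n => ((hint (hY n)).sub (hint (hX.forall_aemeasurable n))).aestronglyMeasurable)
      (integrable_const C) (fun n => ae_of_all _ fun ω => hC _ _) ?_
    filter_upwards [h] with ω hω
    have h3 : Tendsto (fun n => (F (X n ω), F (Y n ω))) atTop (𝓤 ℝ) :=
      Tendsto.comp hL.uniformContinuous hω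
    rw [tendsto_uniformity_iff_dist_tendsto_zero] at h3
    refine (tendsto_zero_iff_abs_tendsto_zero _).2 (h3.congr fun n => ?_)
    rw [Real.dist_eq, abs_sub_comm]
    rfl
  rw [integral_zero] at h2
  have h4 := h2.add h1
  rw [zero_add] at h4
  refine h4.congr fun n => ?_
  simp only [ProbabilityMeasure.coe_mk]
  rw [hmap (hY n), hmap (hX.forall_aemeasurable n),
    integral_sub (hint (hY n)) (hint (hX.forall_aemeasurable n)), sub_add_cancel]

end Distribution

/-! ### Densities of image measures and the transfer operators -/

section PushDensity

variable {X Y Z : Type*} [MeasurableSpace X] [MeasurableSpace Y] [MeasurableSpace Z]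
  {ν : Measure X} {μ : Measure Y} {ρ : Measure Z} {T : X → Y} {S : Y → Z}
  {g : X → ℝ} {h : Y → ℝ} {k : Z → ℝ}

/-- `h` is the density with respect to `μ` of the image under `T` of `g dν`. -/
structure IsPushDensity (ν : Measure X) (μ : Measure Y) (T : X → Y) (g : X → ℝ) (h : Y → ℝ) :
    Prop where
  measurable : Measurable h
  integrable : Integrable h μ
  setIntegral_eq : ∀ B, MeasurableSet B → ∫ y in B, h y ∂μ = ∫ x in T ⁻¹' B, g x ∂ν

theorem isPushDensity_id (hg : Measurable g) (hgi : Integrable g ν) :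
    IsPushDensity ν ν id g g :=
  ⟨hg, hgi, fun _ _ => rfl⟩

theorem IsPushDensity.comp (hk : IsPushDensity μ ρ S h k) (hh : IsPushDensity ν μ T g h)
    (hS : Measurable S) : IsPushDensity ν ρ (S ∘ T) g k :=
  ⟨hk.measurable, hk.integrable, fun B hB =>
    (hk.setIntegral_eq B hB).trans (hh.setIntegral_eq _ (hS hB))⟩

/-- Preimages of $\mu$-null sets are $\nu$-null, so the image measure is absolutely continuous and
its Radon–Nikodym derivative recovers it. -/
theorem isPushDensity_rnDeriv [IsFiniteMeasure μ] (hT : MeasurePreserving T ν μ)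
    (hg : Integrable g ν) :
    IsPushDensity ν μ T g (SignedMeasure.rnDeriv ((ν.withDensityᵥ g).map T) μ) := by
  set s : SignedMeasure Y := (ν.withDensityᵥ g).map T with hs
  have happ : ∀ B, MeasurableSet B → s B = ∫ x in T ⁻¹' B, g x ∂ν := fun B hB => by
    rw [hs, VectorMeasure.map_apply _ hT.measurable hB,
      withDensityᵥ_apply hg (hT.measurable hB)]
  have hac : s ≪ᵥ μ.toENNRealVectorMeasure := by
    refine VectorMeasure.AbsolutelyContinuous.mk fun B hB hB0 => ?_
    rw [Measure.toENNRealVectorMeasure_apply_measurable hB] at hB0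
    rw [happ B hB, Measure.restrict_eq_zero.2, integral_zero_measure]
    rw [hT.measure_preimage hB.nullMeasurableSet, hB0]
  have hi := SignedMeasure.integrable_rnDeriv s μ
  refine ⟨SignedMeasure.measurable_rnDeriv s μ, hi, fun B hB => ?_⟩
  rw [← happ B hB, ← withDensityᵥ_apply hi hB,
    (SignedMeasure.absolutelyContinuous_iff_withDensityᵥ_rnDeriv_eq s μ).1 hac]

/-- The function $h\circ T$ is the conditional expectation of $g$ given $T$. Pulling out $f\circ T$
gives the duality for all $f$ with $g\,(f\circ T)$ integrable, not only bounded ones. -/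
theorem IsPushDensity.integral_mul [IsFiniteMeasure ν] (hh : IsPushDensity ν μ T g h)
    (hT : MeasurePreserving T ν μ) (hg : Integrable g ν) {f : Y → ℝ} (hf : Measurable f)
    (hgf : Integrable (fun x => g x * f (T x)) ν) :
    ∫ y, h y * f y ∂μ = ∫ x, g x * f (T x) ∂ν := by
  have hm : ‹MeasurableSpace Y›.comap T ≤ ‹MeasurableSpace X› := hT.measurable.comap_le
  have hTm : Measurable[‹MeasurableSpace Y›.comap T] T := comap_measurable T
  have hcond : h ∘ T =ᵐ[ν] ν[g | ‹MeasurableSpace Y›.comap T] := by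
    have hhT : Integrable (h ∘ T) ν := hT.integrable_comp_of_integrable hh.integrable
    refine ae_eq_condExp_of_forall_setIntegral_eq hm hg (fun _ _ _ => hhT.integrableOn) ?_
      (hh.measurable.comp hTm).stronglyMeasurable.aestronglyMeasurable
    rintro _ ⟨B, hB, rfl⟩ -
    rw [← hh.setIntegral_eq B hB]
    exact integral_comp_measurePreserving (hT.restrict_preimage hB)
      hh.measurable.stronglyMeasurable.aestronglyMeasurable
  have hpull : ν[g * (f ∘ T) | ‹MeasurableSpace Y›.comap T] =ᵐ[ν] ν[g | ‹MeasurableSpace Y›.comap T] * (f ∘ T) :=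
    condExp_mul_of_stronglyMeasurable_right (hf.comp hTm).stronglyMeasurable hgf hg
  calc ∫ y, h y * f y ∂μ = ∫ x, h (T x) * f (T x) ∂ν :=
        (integral_comp_measurePreserving hT (h := fun y => h y * f y)
          (hh.measurable.mul hf).stronglyMeasurable.aestronglyMeasurable).symm
    _ = ∫ x, (ν[g | ‹MeasurableSpace Y›.comap T] * (f ∘ T)) x ∂ν := by
        refine integral_congr_ae ?_
        filter_upwards [hcond] with x hx
        simp only [Pi.mul_apply, Function.comp_apply, ← hx]
    _ = ∫ x, (ν[g * (f ∘ T) | ‹MeasurableSpace Y›.comap T]) x ∂ν := integral_congr_ae hpull.symm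
    _ = ∫ x, g x * f (T x) ∂ν := integral_condExp hm

end PushDensity

section Cocycle

variable {Ω M : Type*} {σ : Ω → Ω} {T : Ω → M → M}

theorem skewProduct_iterate (n : ℕ) (ω : Ω) (x : M) :
    (skewProduct σ T)^[n] (ω, x) = (σ^[n] ω, cocycle σ T n ω x) := by
  induction n with
  | zero => rfl
  | succ n ih =>
    rw [Function.iterate_succ_apply', ih, Function.iterate_succ_apply']
    rfl

variable [MeasurableSpace Ω] [MeasurableSpace M]

theorem measurable_fibreMap (hT : Measurable fun z : Ω × M => T z.1 z.2) (ω : Ω) :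
    Measurable (T ω) :=
  hT.comp measurable_prodMk_left

theorem measurable_cocycle (hT : Measurable fun z : Ω × M => T z.1 z.2) (n : ℕ) (ω : Ω) :
    Measurable (cocycle σ T n ω) := by
  induction n with
  | zero => exact measurable_id
  | succ n ih => exact (measurable_fibreMap hT _).comp ih

variable {κ : Kernel Ω M} {ω : Ω}

theorem measurePreserving_cocycle (hT : Measurable fun z : Ω × M => T z.1 z.2)
    (hκ : ∀ j : ℕ, (κ (σ^[j] ω)).map (T (σ^[j] ω)) = κ (σ (σ^[j] ω))) (n : ℕ) :
    MeasurePreserving (cocycle σ T n ω) (κ ω) (κ (σ^[n] ω)) := by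
  induction n with
  | zero => exact MeasurePreserving.id _
  | succ n ih =>
    rw [Function.iterate_succ_apply']
    exact MeasurePreserving.comp ⟨measurable_fibreMap hT _, hκ n⟩ ih

theorem isPushDensity_transferIter [IsMarkovKernel κ]
    (hT : Measurable fun z : Ω × M => T z.1 z.2)
    (hκ : ∀ j : ℕ, (κ (σ^[j] ω)).map (T (σ^[j] ω)) = κ (σ (σ^[j] ω))) {g : M → ℝ}
    (hg : Measurable g) (hgi : Integrable g (κ ω)) (n : ℕ) :
    IsPushDensity (κ ω) (κ (σ^[n] ω)) (cocycle σ T n ω) g (transferIter σ T κ n ω g) := by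
  induction n with
  | zero => exact isPushDensity_id hg hgi
  | succ n ih =>
    rw [Function.iterate_succ_apply']
    exact (isPushDensity_rnDeriv ⟨measurable_fibreMap hT _, hκ n⟩ ih.integrable).comp ih
      (measurable_fibreMap hT _)

end Cocycle

/-! ### Series of random bounds -/

section Series

variable {Ω : Type*} [MeasurableSpace Ω] {P : Measure Ω}

/-- Minkowski's inequality for the partial sums, then Fatou's lemma. -/
theorem memLp_tsum_of_tsum_eLpNorm_ne_top {b : ℕ → Ω → ℝ} {q : ℝ≥0∞} (hq : 1 ≤ q)
    (hbm : ∀ n, Measurable (b n)) (hb : ∑' n, eLpNorm (b n) q P ≠ ∞) :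
    MemLp (fun ω => ∑' n, b n ω) q P := by
  refine ⟨(Measurable.tsum hbm).aestronglyMeasurable, ?_⟩
  have hlim : ∀ᵐ ω ∂P, Tendsto (fun N => (∑ n ∈ Finset.range N, b n) ω) atTop
      (𝓝 (∑' n, b n ω)) := by
    filter_upwards [summable_norm_of_tsum_eLpNorm_ne_top hq
      (fun n => (hbm n).aestronglyMeasurable) hb] with ω hω
    simpa only [Finset.sum_apply] using hω.of_norm.hasSum.tendsto_sum_nat
  have hm : ∀ N, AEStronglyMeasurable (∑ n ∈ Finset.range N, b n) P := fun N =>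
    Finset.aestronglyMeasurable_sum _ fun n _ => (hbm n).aestronglyMeasurable
  refine lt_of_le_of_lt ((Lp.eLpNorm_lim_le_liminf_eLpNorm hm _ hlim).trans
    (liminf_le_of_frequently_le' (Frequently.of_forall fun N => ?_))) hb.lt_top
  exact (eLpNorm_sum_le (fun n _ => (hbm n).aestronglyMeasurable) hq).trans
    (ENNReal.sum_le_tsum _)

theorem integral_abs_mul_le {X : Type*} [MeasurableSpace X] {μ : Measure X} {f g : X → ℝ}
    (hf : MemLp f 2 μ) (hg : MemLp g 2 μ) :
    ∫ x, |f x * g x| ∂μ ≤ (eLpNorm f 2 μ * eLpNorm g 2 μ).toReal := by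
  have h1 : ∫ x, |f x * g x| ∂μ = (eLpNorm (f • g) 1 μ).toReal := by
    rw [eLpNorm_one_eq_lintegral_enorm]
    exact integral_norm_eq_lintegral_enorm (hf.1.mul hg.1)
  rw [h1]
  exact ENNReal.toReal_mono (ENNReal.mul_ne_top hf.2.ne hg.2.ne)
    (eLpNorm_smul_le_mul_eLpNorm hg.1 hf.1)

end Series

/-! ### The series defining `χ` -/

section Bridge

variable {Ω M : Type*} [MeasurableSpace Ω] [MeasurableSpace M] {P : Measure Ω}
  {κ : Kernel Ω M} {σ : Ω ≃ᵐ Ω} {T : Ω → M → M}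

theorem iterate_apply_symm_iterate (σ : Ω ≃ᵐ Ω) (n : ℕ) (ω : Ω) : σ^[n] (σ.symm^[n] ω) = ω :=
  Function.RightInverse.iterate σ.right_inv n ω

theorem ae_forall_symm_iterate (hσ : MeasurePreserving σ P P) {p : ℕ → Ω → Prop}
    (h : ∀ n, ∀ᵐ ω ∂P, p n ω) : ∀ᵐ ω ∂P, ∀ n, p n (σ.symm^[n] ω) :=
  ae_all_iff.2 fun n => ((hσ.symm σ).iterate n).quasiMeasurePreserving.ae (h n)

theorem ae_forall_iterate_map_eq (hσ : MeasurePreserving σ P P)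
    (hκ : ∀ᵐ ω ∂P, (κ ω).map (T ω) = κ (σ ω)) :
    ∀ᵐ ω ∂P, ∀ j : ℕ, (κ (σ^[j] ω)).map (T (σ^[j] ω)) = κ (σ (σ^[j] ω)) :=
  ae_all_iff.2 fun j => (hσ.iterate j).quasiMeasurePreserving.ae hκ

/-- `L_{σ^{-n} ω}^{(n)} (u_{σ^{-n} ω})`. -/
noncomputable def pastTransfer (σ : Ω ≃ᵐ Ω) (T : Ω → M → M) (κ : Kernel Ω M) (u : Ω × M → ℝ) (n : ℕ) (ω : Ω) :
    M → ℝ :=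
  transferIter σ T κ n (σ.symm^[n] ω) (fun x => u (σ.symm^[n] ω, x))

variable [IsProbabilityMeasure P] [IsMarkovKernel κ]

theorem measurePreserving_fst_compProd : MeasurePreserving Prod.fst (P ⊗ₘ κ) P :=
  ⟨measurable_fst, Measure.fst_compProd P κ⟩

theorem integrable_integral_compProd {f : Ω × M → ℝ} (hf : Integrable f (P ⊗ₘ κ)) :
    Integrable (fun ω => ∫ x, f (ω, x) ∂(κ ω)) P := by
  rw [Measure.compProd] at hf
  simpa using hf.integral_compProd

theorem memLp_compProd_of_bound {u : Ω × M → ℝ} {w : Ω → ℝ} {q : ℝ≥0∞} (hu : Measurable u)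
    (hwm : Measurable w) (hw : MemLp w q P) (h : ∀ᵐ ω ∂P, ∀ᵐ x ∂(κ ω), |u (ω, x)| ≤ w ω) :
    MemLp u q (P ⊗ₘ κ) := by
  refine (hw.comp_measurePreserving measurePreserving_fst_compProd).mono
    hu.aestronglyMeasurable ?_
  have hmeas : MeasurableSet {z : Ω × M | |u z| ≤ w z.1} :=
    measurableSet_le hu.abs (hwm.comp measurable_fst)
  filter_upwards [Measure.ae_compProd_of_ae_ae hmeas h] with z hz
  exact hz.trans (le_abs_self _)

theorem ae_isPushDensity_pastTransfer (hσ : MeasurePreserving σ P P)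
    (hT : Measurable fun z : Ω × M => T z.1 z.2) (hκ : ∀ᵐ ω ∂P, (κ ω).map (T ω) = κ (σ ω))
    {u : Ω × M → ℝ} (hu : Measurable u) (hui : Integrable u (P ⊗ₘ κ)) :
    ∀ᵐ ω ∂P, ∀ n : ℕ,
      Integrable (fun x => u (σ.symm^[n] ω, x)) (κ (σ.symm^[n] ω)) ∧
      MeasurePreserving (cocycle σ T n (σ.symm^[n] ω)) (κ (σ.symm^[n] ω)) (κ ω) ∧
      IsPushDensity (κ (σ.symm^[n] ω)) (κ ω) (cocycle σ T n (σ.symm^[n] ω))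
        (fun x => u (σ.symm^[n] ω, x)) (pastTransfer σ T κ u n ω) := by
  have hui' := ((Measure.integrable_compProd_iff hu.aestronglyMeasurable).1 hui).1
  filter_upwards [ae_forall_symm_iterate hσ fun _ => ae_forall_iterate_map_eq hσ hκ,
    ae_forall_symm_iterate hσ fun _ => hui'] with ω h1 h2 n
  have h3 := measurePreserving_cocycle hT (h1 n) n
  have h4 := isPushDensity_transferIter hT (h1 n)
    (g := fun x => u (σ.symm^[n] ω, x)) (hu.comp measurable_prodMk_left) (h2 n) n
  rw [iterate_apply_symm_iterate] at h3 h4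
  exact ⟨h2 n, h3, h4⟩

theorem ae_integral_pastTransfer_mul (hσ : MeasurePreserving σ P P)
    (hT : Measurable fun z : Ω × M => T z.1 z.2) (hκ : ∀ᵐ ω ∂P, (κ ω).map (T ω) = κ (σ ω))
    {u f : Ω × M → ℝ} (hu : Measurable u) (hui : Integrable u (P ⊗ₘ κ)) (hf : Measurable f) {n : ℕ}
    (huf : Integrable (fun z => u z * f ((skewProduct σ T)^[n] z)) (P ⊗ₘ κ)) :
    ∀ᵐ ω ∂P, ∫ x, pastTransfer σ T κ u n ω x * f (ω, x) ∂(κ ω) =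
      ∫ x, u (σ.symm^[n] ω, x) * f ((skewProduct σ T)^[n] (σ.symm^[n] ω, x))
        ∂(κ (σ.symm^[n] ω)) := by
  filter_upwards [ae_isPushDensity_pastTransfer hσ hT hκ hu hui,
    ((hσ.symm σ).iterate n).quasiMeasurePreserving.ae (((Measure.integrable_compProd_iff huf.aestronglyMeasurable).1 huf).1)] with ω h1 h2
  obtain ⟨hi, hmp, hpd⟩ := h1 n
  have h3 : ∀ x, (skewProduct σ T)^[n] (σ.symm^[n] ω, x) =
      (ω, cocycle σ T n (σ.symm^[n] ω) x) := fun x => by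
    rw [skewProduct_iterate, iterate_apply_symm_iterate]
  simp only [h3] at h2 ⊢
  exact hpd.integral_mul hmp hi (f := fun x => f (ω, x)) (hf.comp measurable_prodMk_left) h2

/-- On each fibre, the $n$-th term of $\chi$ tested against $f$ equals an integral over the fibre at
$\sigma^{-n}\omega$; integrating over $\omega$ and using invariance of $\mathbb P$ gives $\int
u\,(f\circ\tau^n)\,d\mu$. The bounds $b_n$ justify exchanging the sum first with the fibre integral,
then with the integral over $\Omega$. -/
theorem isDualSum_of_bound (hσ : MeasurePreserving σ P P)
    (hτ : MeasurePreserving (skewProduct σ T) (P ⊗ₘ κ) (P ⊗ₘ κ))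
    (hT : Measurable fun z : Ω × M => T z.1 z.2) (hκ : ∀ᵐ ω ∂P, (κ ω).map (T ω) = κ (σ ω))
    {u χ : Ω × M → ℝ} (hu : Measurable u) (hu2 : MemLp u 2 (P ⊗ₘ κ))
    (hχ2 : MemLp χ 2 (P ⊗ₘ κ))
    {b : ℕ → Ω → ℝ} (hbm : ∀ n, Measurable (b n)) (hb0 : ∀ n ω, 0 ≤ b n ω)
    (hb : ∑' n, eLpNorm (b n) 2 P ≠ ∞)
    (hbd : ∀ᵐ ω ∂P, ∀ n, ∀ᵐ x ∂(κ ω), |pastTransfer σ T κ u (n + 1) ω x| ≤ b n ω)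
    (hχ : ∀ᵐ ω ∂P, ∀ᵐ x ∂(κ ω), χ (ω, x) = ∑' n, pastTransfer σ T κ u (n + 1) ω x) :
    IsDualSum (P ⊗ₘ κ) (skewProduct σ T) u χ := by
  intro f hfm hf
  set τ := skewProduct σ T
  have hfi : Integrable f (P ⊗ₘ κ) := hf.integrable one_le_two
  have hprod : ∀ n : ℕ, Integrable (fun z => u z * f (τ^[n] z)) (P ⊗ₘ κ) := fun n =>
    hu2.integrable_mul (hf.comp_measurePreserving (hτ.iterate n))
  set k : ℕ → Ω → ℝ := fun n ω => ∫ x, u (ω, x) * f (τ^[n] (ω, x)) ∂(κ ω) with hk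
  set c : ℕ → Ω → ℝ := fun n ω => k (n + 1) (σ.symm^[n + 1] ω) with hc
  set φ : Ω → ℝ := fun ω => ∫ x, ‖f (ω, x)‖ ∂(κ ω) with hφ
  have hmp : ∀ n : ℕ, MeasurePreserving σ.symm^[n] P P := fun n => (hσ.symm σ).iterate n
  have hki : ∀ n, Integrable (k n) P := fun n => integrable_integral_compProd (hprod n)
  have hci : ∀ n, Integrable (c n) P := fun n =>
    (hmp (n + 1)).integrable_comp_of_integrable (hki (n + 1))
  have hcint : ∀ n, ∫ ω, c n ω ∂P = ∫ z, u z * f (τ^[n + 1] z) ∂(P ⊗ₘ κ) := fun n => by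
    rw [Measure.integral_compProd (hprod (n + 1))]
    exact integral_comp_measurePreserving (hmp (n + 1)) (hki (n + 1)).aestronglyMeasurable
  obtain ⟨hfω, hφi⟩ := (Measure.integrable_compProd_iff hfm.aestronglyMeasurable).1 hfi
  have hcω : ∀ᵐ ω ∂P, ∀ n, ∫ x, pastTransfer σ T κ u (n + 1) ω x * f (ω, x) ∂(κ ω) = c n ω :=
    ae_all_iff.2 fun n => ae_integral_pastTransfer_mul hσ hT hκ hu (hu2.integrable one_le_two) hfm
      (hprod (n + 1))
  have hFint : ∀ᵐ ω ∂P, ∀ n,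
      Integrable (fun x => pastTransfer σ T κ u (n + 1) ω x * f (ω, x)) (κ ω) ∧
      ∫ x, ‖pastTransfer σ T κ u (n + 1) ω x * f (ω, x)‖ ∂(κ ω) ≤ b n ω * φ ω := by
    filter_upwards [ae_isPushDensity_pastTransfer hσ hT hκ hu (hu2.integrable one_le_two), hfω,
      hbd] with ω h1 h2 h3 n
    have hle : ∀ᵐ x ∂(κ ω), ‖pastTransfer σ T κ u (n + 1) ω x * f (ω, x)‖ ≤
        b n ω * ‖f (ω, x)‖ := by
      filter_upwards [h3 n] with x hx
      rw [norm_mul]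
      exact mul_le_mul_of_nonneg_right hx (norm_nonneg _)
    have hdom := h2.norm.const_mul (b n ω)
    have hint : Integrable (fun x => pastTransfer σ T κ u (n + 1) ω x * f (ω, x)) (κ ω) :=
      hdom.mono' (((h1 (n + 1)).2.2.measurable.mul
        (hfm.comp measurable_prodMk_left)).aestronglyMeasurable) hle
    refine ⟨hint, ?_⟩
    rw [hφ, ← integral_const_mul]
    exact integral_mono_ae hint.norm hdom hle
  have hsumc : ∀ᵐ ω ∂P, ∑' n, c n ω = ∫ x, χ (ω, x) * f (ω, x) ∂(κ ω) := by
    filter_upwards [hcω, hFint, hχ, summable_norm_of_tsum_eLpNorm_ne_top one_le_two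
      (fun n => (hbm n).aestronglyMeasurable) hb] with ω h1 h2 h3 h4
    have hs : Summable fun n => ∫ x, ‖pastTransfer σ T κ u (n + 1) ω x * f (ω, x)‖ ∂(κ ω) :=
      Summable.of_nonneg_of_le (fun n => integral_nonneg fun x => norm_nonneg _)
        (fun n => (h2 n).2) (h4.of_norm.mul_right _)
    have h5 := (hasSum_integral_of_summable_integral_norm (fun n => (h2 n).1) hs).tsum_eq
    simp only [h1] at h5
    rw [h5]
    refine integral_congr_ae ?_
    filter_upwards [h3] with x hx
    rw [hx, tsum_mul_right]
  -- By Cauchy–Schwarz on $\Omega\times M$, the $n$-th integral is at most $\|b_n\|_2\|f\|_2$.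
  have hcsum : Summable fun n => ∫ ω, ‖c n ω‖ ∂P := by
    have hbn : ∀ n, eLpNorm (b n) 2 P ≠ ∞ := ENNReal.ne_top_of_tsum_ne_top hb
    refine Summable.of_nonneg_of_le (fun n => integral_nonneg fun ω => norm_nonneg _)
      (fun n => ?_) ((ENNReal.summable_toReal hb).mul_right (eLpNorm f 2 (P ⊗ₘ κ)).toReal)
    have hbLp' : MemLp (b n) 2 P := ⟨(hbm n).aestronglyMeasurable, (hbn n).lt_top⟩
    have hbLp : MemLp (fun z : Ω × M => b n z.1) 2 (P ⊗ₘ κ) :=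
      hbLp'.comp_measurePreserving measurePreserving_fst_compProd
    have hbf : Integrable (fun z : Ω × M => |b n z.1 * f z|) (P ⊗ₘ κ) :=
      (hbLp.integrable_mul hf).abs
    have h1 : ∀ ω, ∫ x, |b n ω * f (ω, x)| ∂(κ ω) = b n ω * φ ω := fun ω => by
      simp only [abs_mul, abs_of_nonneg (hb0 n ω)]
      exact integral_const_mul _ _
    have h2 : Integrable (fun ω => b n ω * φ ω) P := by
      have := integrable_integral_compProd hbf
      simpa only [h1] using this
    calc ∫ ω, ‖c n ω‖ ∂P ≤ ∫ ω, b n ω * φ ω ∂P := by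
          refine integral_mono_ae (hci n).norm h2 ?_
          filter_upwards [hcω, hFint] with ω h3 h4
          rw [← h3 n]
          exact (norm_integral_le_integral_norm _).trans (h4 n).2
      _ = ∫ z : Ω × M, |b n z.1 * f z| ∂(P ⊗ₘ κ) := by
          rw [Measure.integral_compProd hbf]
          simp only [h1]
      _ ≤ _ := by
          refine (integral_abs_mul_le hbLp hf).trans (le_of_eq ?_)
          rw [ENNReal.toReal_mul]
          congr 2
          exact eLpNorm_comp_measurePreserving (hbm n).aestronglyMeasurable
            measurePreserving_fst_compProd
  have hfinal := hasSum_integral_of_summable_integral_norm hci hcsum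
  simp only [hcint] at hfinal
  rw [integral_congr_ae hsumc] at hfinal
  rwa [← Measure.integral_compProd (f := fun z => χ z * f z) (hχ2.integrable_mul hf)] at hfinal

end Bridge

/-! ### Jointly measurable versions of the terms of the series -/

section Version

theorem ae_eq_of_forall_setIntegral_eq_of_isPiSystem {X : Type*} [m : MeasurableSpace X]
    {μ : Measure X} {f g : X → ℝ} (hf : Integrable f μ) (hg : Integrable g μ) {C : Set (Set X)}
    (hC : m = MeasurableSpace.generateFrom C) (hpi : IsPiSystem C) (huniv : univ ∈ C)
    (h : ∀ B ∈ C, ∫ x in B, f x ∂μ = ∫ x in B, g x ∂μ) : f =ᵐ[μ] g := by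
  refine hf.ae_eq_of_forall_setIntegral_eq f g hg fun B hB hB' => ?_
  clear hB'
  induction B, hB using MeasurableSpace.induction_on_inter hC hpi with
  | empty => simp
  | basic B hB => exact h B hB
  | compl B hB ih =>
    have h1 := h univ huniv
    rw [setIntegral_univ, setIntegral_univ] at h1
    rw [setIntegral_compl hB hf, setIntegral_compl hB hg, ih, h1]
  | iUnion B hd hB ih =>
    rw [integral_iUnion hB hd hf.integrableOn, integral_iUnion hB hd hg.integrableOn]
    exact tsum_congr ih

variable {Ω M : Type*} [MeasurableSpace Ω] [MeasurableSpace M] {P : Measure Ω}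
  {κ : Kernel Ω M} {σ : Ω ≃ᵐ Ω} {T : Ω → M → M} [IsProbabilityMeasure P] [IsMarkovKernel κ]

/-- The density of $\tau^n_*(u\,\mu)$ with respect to $\mu$ is jointly measurable. Disintegrated
over rectangles, it has the same fibre integrals as the fibrewise densities. -/
theorem exists_measurable_pastTransfer [MeasurableSpace.CountablyGenerated M]
    (hσ : MeasurePreserving σ P P)
    (hτ : MeasurePreserving (skewProduct σ T) (P ⊗ₘ κ) (P ⊗ₘ κ))
    (hT : Measurable fun z : Ω × M => T z.1 z.2) (hκ : ∀ᵐ ω ∂P, (κ ω).map (T ω) = κ (σ ω))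
    {u : Ω × M → ℝ} (hu : Measurable u) (hui : Integrable u (P ⊗ₘ κ)) (n : ℕ) :
    ∃ U : Ω × M → ℝ, Measurable U ∧
      ∀ᵐ ω ∂P, ∀ᵐ x ∂(κ ω), U (ω, x) = pastTransfer σ T κ u n ω x := by
  have hU := isPushDensity_rnDeriv (hτ.iterate n) hui
  set U := SignedMeasure.rnDeriv (((P ⊗ₘ κ).withDensityᵥ u).map (skewProduct σ T)^[n]) (P ⊗ₘ κ)
  refine ⟨U, hU.measurable, ?_⟩
  -- the integrals over products of measurable sets agree
  have hind : ∀ D : Set (Ω × M), MeasurableSet D →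
      Integrable (fun z => u z * D.indicator 1 ((skewProduct σ T)^[n] z)) (P ⊗ₘ κ) := fun D hD => by
    refine (hui.indicator ((hτ.iterate n).measurable hD)).congr (ae_of_all _ fun z => ?_)
    by_cases hz : (skewProduct σ T)^[n] z ∈ D <;> simp [hz]
  have hfib : ∀ B : Set M, MeasurableSet B → ∀ᵐ ω ∂P,
      ∫ x in B, U (ω, x) ∂(κ ω) = ∫ x in B, pastTransfer σ T κ u n ω x ∂(κ ω) := by
    intro B hB
    have hUB : Integrable (fun z : Ω × M => (univ ×ˢ B).indicator U z) (P ⊗ₘ κ) :=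
      hU.integrable.indicator (MeasurableSet.univ.prod hB)
    have hsec : ∀ (g : M → ℝ) (ω : Ω) (A : Set Ω),
        ∫ x, g x * (A ×ˢ B).indicator 1 (ω, x) ∂(κ ω) =
          A.indicator (fun ω => ∫ x in B, g x ∂(κ ω)) ω := fun g ω A => by
      by_cases hω : ω ∈ A
      · rw [indicator_of_mem hω, ← integral_indicator hB]
        refine integral_congr_ae (ae_of_all _ fun x => ?_)
        by_cases hx : x ∈ B <;> simp [hω, hx]
      · simp [hω]
    have hint1 : Integrable (fun ω => ∫ x in B, U (ω, x) ∂(κ ω)) P := by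
      refine (integrable_integral_compProd hUB).congr (ae_of_all _ fun ω => ?_)
      simp only
      rw [← integral_indicator hB]
      refine integral_congr_ae (ae_of_all _ fun x => ?_)
      by_cases hx : x ∈ B <;> simp [hx]
    -- The fibre integrals of the transferred function are not known to be measurable in $\omega$;
    -- integrability is inherited from an almost everywhere equal function obtained by duality.
    have key : ∀ A : Set Ω, MeasurableSet A →
        Integrable (A.indicator fun ω => ∫ x in B, pastTransfer σ T κ u n ω x ∂(κ ω)) P ∧
        ∫ ω, A.indicator (fun ω => ∫ x in B, pastTransfer σ T κ u n ω x ∂(κ ω)) ω ∂P =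
          ∫ z in (skewProduct σ T)^[n] ⁻¹' (A ×ˢ B), u z ∂(P ⊗ₘ κ) := by
      intro A hA
      have hAB := hA.prod hB
      have h1 := ae_integral_pastTransfer_mul hσ hT hκ hu hui
        (f := (A ×ˢ B).indicator 1) (measurable_one.indicator hAB) (hind _ hAB)
      simp only [hsec _ _ A] at h1
      have h2 := integrable_integral_compProd (hind _ hAB)
      have hmp := (hσ.symm σ).iterate n
      have h3 : Integrable (fun ω => ∫ x, u (σ.symm^[n] ω, x) *
          (A ×ˢ B).indicator 1 ((skewProduct σ T)^[n] (σ.symm^[n] ω, x)) ∂(κ (σ.symm^[n] ω))) P :=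
        hmp.integrable_comp_of_integrable h2
      have h1' : (A.indicator fun ω => ∫ x in B, pastTransfer σ T κ u n ω x ∂(κ ω)) =ᵐ[P]
          fun ω => ∫ x, u (σ.symm^[n] ω, x) *
          (A ×ˢ B).indicator 1 ((skewProduct σ T)^[n] (σ.symm^[n] ω, x)) ∂(κ (σ.symm^[n] ω)) := by
        filter_upwards [h1] with ω hω
        rw [← hω]
        by_cases hωA : ω ∈ A <;> simp [hωA]
      refine ⟨h3.congr h1'.symm, ?_⟩
      rw [integral_congr_ae h1', integral_comp_measurePreserving hmp h2.aestronglyMeasurable,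
        ← Measure.integral_compProd (hind _ hAB),
        ← integral_indicator ((hτ.iterate n).measurable hAB)]
      refine integral_congr_ae (ae_of_all _ fun z => ?_)
      by_cases hz : (skewProduct σ T)^[n] z ∈ A ×ˢ B <;> simp [indicator, hz]
    have hint2 : Integrable (fun ω => ∫ x in B, pastTransfer σ T κ u n ω x ∂(κ ω)) P := by
      simpa using (key univ MeasurableSet.univ).1
    refine hint1.ae_eq_of_forall_setIntegral_eq _ _ hint2 fun A hA _ => ?_
    rw [← integral_indicator hA (f := fun ω => ∫ x in B, pastTransfer σ T κ u n ω x ∂(κ ω)),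
      (key A hA).2, ← hU.setIntegral_eq _ (hA.prod hB),
      Measure.setIntegral_compProd hA hB hU.integrable.integrableOn]
  -- The exceptional set of $\omega$ depends on $B$, so only countably many $B$ are allowed; a
  -- countable generating algebra still determines the density.
  set C := generateSetAlgebra (MeasurableSpace.countableGeneratingSet M)
  have hCcount : C.Countable :=
    countable_generateSetAlgebra MeasurableSpace.countable_countableGeneratingSet
  have hCgen : ‹MeasurableSpace M› = MeasurableSpace.generateFrom C := by
    rw [generateFrom_generateSetAlgebra_eq, MeasurableSpace.generateFrom_countableGeneratingSet]
  have hCalg : IsSetAlgebra C := isSetAlgebra_generateSetAlgebra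
  have hCm : ∀ B ∈ C, MeasurableSet B := fun B hB => by
    rw [hCgen]
    exact MeasurableSpace.measurableSet_generateFrom hB
  have hall : ∀ᵐ ω ∂P, ∀ B ∈ C,
      ∫ x in B, U (ω, x) ∂(κ ω) = ∫ x in B, pastTransfer σ T κ u n ω x ∂(κ ω) :=
    (ae_ball_iff hCcount).2 fun B hB => hfib B (hCm B hB)
  filter_upwards [hall, ae_isPushDensity_pastTransfer hσ hT hκ hu hui,
    ((Measure.integrable_compProd_iff hU.measurable.aestronglyMeasurable).1 hU.integrable).1]
    with ω h1 h2 h3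
  exact ae_eq_of_forall_setIntegral_eq_of_isPiSystem h3 (h2 n).2.2.integrable hCgen
    (fun s hs t ht _ => hCalg.inter_mem hs ht) hCalg.univ_mem h1

end Version

/-! ### Hölder bounds -/

section Hoelder

variable {Ω : Type*} [MeasurableSpace Ω] {P : Measure Ω}

/-- Hölder's inequality twice: $KW$ lies in $L^t$ with $1/t=1/r+1/p$, and pairing it with $A_n\in
L^{q_0}$ gives exponent $s$. -/
theorem tsum_eLpNorm_mul_ne_top {K W : Ω → ℝ} {A : ℕ → Ω → ℝ} {q₀ p r s : ℝ≥0∞}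
    (hprs : s⁻¹ = r⁻¹ + p⁻¹ + q₀⁻¹) (hK : MemLp K r P) (hW : MemLp W p P)
    (hAm : ∀ n, Measurable (A n)) (hA : ∑' n, eLpNorm (A n) q₀ P < ∞) :
    ∑' n, eLpNorm (fun ω => K ω * A n ω * W ω) s P ≠ ∞ := by
  set t : ℝ≥0∞ := (r⁻¹ + p⁻¹)⁻¹ with ht
  have : ENNReal.HolderTriple r p t := ⟨by rw [ht, inv_inv]⟩
  have : ENNReal.HolderTriple t q₀ s := ⟨by rw [ht, inv_inv, hprs]⟩
  have hKW : MemLp (fun ω => K ω * W ω) t P := hW.mul' hK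
  have hle : ∀ n, eLpNorm (fun ω => K ω * A n ω * W ω) s P ≤
      eLpNorm (fun ω => K ω * W ω) t P * eLpNorm (A n) q₀ P := fun n => by
    have h := eLpNorm_smul_le_mul_eLpNorm (hAm n).aestronglyMeasurable hKW.1 (p := t) (q := q₀)
      (r := s)
    refine le_trans (le_of_eq ?_) h
    congr 1
    ext ω
    simp only [Pi.smul_apply', smul_eq_mul]
    ring
  refine ne_top_of_le_ne_top ?_ (ENNReal.tsum_le_tsum hle)
  rw [ENNReal.tsum_mul_left]
  exact ENNReal.mul_ne_top hKW.2.ne hA.ne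

end Hoelder

/-! ### Iterated processes -/

section Processes

variable {Ω M : Type*} {e : ℕ} {σ : Ω → Ω} {T : Ω → M → M} {v : Ω × M → Fin e → ℝ} {β γ : Fin e}

theorem iteratedSum_eq_pairSum (ω : Ω) (x : M) (N : ℕ) :
    iteratedSum σ T v β γ ω x N =
      pairSum (skewProduct σ T) (fun z => v z β) (fun z => v z γ) (ω, x) N := by
  simp only [iteratedSum, pairSum, skewProduct_iterate]

/-- The difference of the centrings contributes $t(c_n-c'_n)\to tS$, which cancels the limit of the
difference of the processes. -/
theorem tendsto_uniformity_recenteredPath {v' : Ω × M → Fin e → ℝ} {ω : Ω} {x : M} {S : ℝ}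
    {c c' : ℕ → ℝ} (hc : Tendsto (fun n => c n - c' n) atTop (𝓝 S))
    (h : ∀ C : Set ℝ≥0, IsCompact C → TendstoUniformlyOn (fun (n : ℕ) (t : ℝ≥0) =>
      iteratedProcess σ T v β γ ω n x t - iteratedProcess σ T v' β γ ω n x t)
      (fun t => (t : ℝ) * S) atTop C) :
    Tendsto (fun n => (recenteredPath σ T v β γ ω n (c n) x,
      recenteredPath σ T v' β γ ω n (c' n) x)) atTop (uniformity Skorokhod) := by
  refine tendsto_uniformity_skorokhod fun R => ?_
  have hR : IsCompact (Iic R) := by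
    rw [← Icc_bot]
    exact isCompact_Icc
  have h1 : TendstoUniformlyOn (fun (n : ℕ) (t : ℝ≥0) => (t : ℝ) * (c n - c' n))
      (fun t => (t : ℝ) * S) atTop (Iic R) := by
    rw [Metric.tendstoUniformlyOn_iff]
    intro ε hε
    have hpos : (0 : ℝ) < R + 1 := by positivity
    filter_upwards [Metric.tendsto_nhds.1 hc (ε / (R + 1)) (by positivity)] with n hn t ht
    have htR : (t : ℝ) ≤ R + 1 := (NNReal.coe_le_coe.2 ht).trans (by linarith)
    rw [Real.dist_eq] at hn ⊢
    rw [← mul_sub, abs_mul, abs_of_nonneg t.coe_nonneg, abs_sub_comm]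
    calc (t : ℝ) * |c n - c' n - S| ≤ (R + 1) * |c n - c' n - S| := by gcongr
      _ < (R + 1) * (ε / (R + 1)) := by gcongr
      _ = ε := by field_simp
  have h2 := (h _ hR).sub h1
  refine (h2.congr (Eventually.of_forall fun n t _ => ?_)).congr_right fun t _ => ?_
  · simp only [recenteredPath, Pi.sub_apply]
    ring
  · simp

variable [MeasurableSpace Ω] [MeasurableSpace M]

theorem measurable_recenteredPath (hT : Measurable fun z : Ω × M => T z.1 z.2) (hv : Measurable v)
    (ω : Ω) (n : ℕ) (c : ℝ) : Measurable (recenteredPath σ T v β γ ω n c) := by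
  have h1 : Measurable fun (x : M) (N : ℕ) => iteratedSum σ T v β γ ω x N := by
    have h2 : ∀ (i : ℕ) (α : Fin e), Measurable fun x => v (σ^[i] ω, cocycle σ T i ω x) α :=
      fun i α => (measurable_pi_apply α).comp
        (hv.comp (measurable_prodMk_left.comp (measurable_cocycle hT i ω)))
    exact measurable_pi_iff.2 fun N => Finset.measurable_fun_sum _ fun j _ =>
      Finset.measurable_fun_sum _ fun i _ => (h2 i β).mul (h2 j γ)
  exact (continuous_stepPath n c).measurable.comp h1

end Processes

/-! ### The limit statements under a random bound summable in $L^s$ -/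

theorem iteratedProcess_limits_of_bound {Ω M : Type*} [MeasurableSpace Ω] {P : Measure Ω}
    [IsProbabilityMeasure P] {σ : Ω ≃ᵐ Ω} (hσp : MeasurePreserving σ P P) [MeasurableSpace M]
    {T : Ω → M → M} (hT : Measurable fun z : Ω × M => T z.1 z.2) {κ : Kernel Ω M}
    [IsMarkovKernel κ] (hκ : ∀ᵐ ω ∂P, (κ ω).map (T ω) = κ (σ ω))
    (hτ : Ergodic (skewProduct σ T) (P.compProd κ)) {s : ℝ≥0∞} (hs : 2 < s) {e : ℕ}
    {v χ : Ω × M → Fin e → ℝ} (hv : Measurable v)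
    (hv2 : ∀ i, MemLp (fun z => v z i) 2 (P.compProd κ)) {b : ℕ → Ω → ℝ}
    (hbm : ∀ n, Measurable (b n)) (hb0 : ∀ n ω, 0 ≤ b n ω)
    (hbs : ∑' n, eLpNorm (b n) s P ≠ ∞)
    (hbd : ∀ᵐ ω ∂P, ∀ (i : Fin e) (n : ℕ), ∀ᵐ x ∂(κ ω),
      |chiTerm σ T κ v i (n + 1) ω x| ≤ b n ω)
    (hχm : Measurable χ) (hχ : IsChi P σ T κ v χ) (β γ : Fin e) :
    (∀ j : ℕ, Integrable (lagProduct σ T v β γ j) (P.compProd κ) ∧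
      Integrable (lagProduct σ T (martingalePart σ T v χ) β γ j) (P.compProd κ)) ∧
    (∃ S : ℝ,
      Tendsto (fun n : ℕ => ∑ j ∈ Finset.Icc 1 n, ∫ z, (lagProduct σ T v β γ j z -
        lagProduct σ T (martingalePart σ T v χ) β γ j z) ∂(P.compProd κ)) atTop (𝓝 S) ∧
      ∀ᵐ ω ∂P, ∀ᵐ x ∂(κ ω), ∀ C : Set ℝ≥0, IsCompact C →
        TendstoUniformlyOn (fun (n : ℕ) (t : ℝ≥0) => iteratedProcess σ T v β γ ω n x t -
          iteratedProcess σ T (martingalePart σ T v χ) β γ ω n x t)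
          (fun t => (t : ℝ) * S) atTop C) ∧
    ∀ᵐ ω ∂P, ∀ (Q : Measure Skorokhod) [IsProbabilityMeasure Q],
      TendstoInDistribution (fun (n : ℕ) (x : M) => recenteredPath σ T v β γ ω n
        (∑ j ∈ Finset.Icc 1 n, ∫ z, lagProduct σ T v β γ j z ∂(P.compProd κ)) x)
        atTop id (fun _ => κ ω) Q ↔
      TendstoInDistribution (fun (n : ℕ) (x : M) =>
        recenteredPath σ T (martingalePart σ T v χ) β γ ω n (∑ j ∈ Finset.Icc 1 n,
          ∫ z, lagProduct σ T (martingalePart σ T v χ) β γ j z ∂(P.compProd κ)) x)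
        atTop id (fun _ => κ ω) Q := by
  have hτp := hτ.toMeasurePreserving
  have h2s : (2 : ℝ≥0∞) ≤ s := hs.le
  have hs1 : 1 ≤ s := one_le_two.trans h2s
  have hvm : ∀ i, Measurable fun z => v z i := fun i => (measurable_pi_apply i).comp hv
  have hble : ∀ q : ℝ≥0∞, q ≤ s → ∑' n, eLpNorm (b n) q P ≠ ∞ := fun q hq =>
    ne_top_of_le_ne_top hbs (ENNReal.tsum_le_tsum fun n =>
      eLpNorm_le_eLpNorm_of_exponent_le hq (hbm n).aestronglyMeasurable)
  have hsummable : ∀ᵐ ω ∂P, Summable fun n => b n ω := by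
    filter_upwards [summable_norm_of_tsum_eLpNorm_ne_top hs1
      (fun n => (hbm n).aestronglyMeasurable) hbs] with ω hω using hω.of_norm
  have hχim : ∀ i, Measurable fun z => χ z i := fun i => (measurable_pi_apply i).comp hχm
  have hχb : ∀ i, ∀ᵐ ω ∂P, ∀ᵐ x ∂(κ ω), |χ (ω, x) i| ≤ ∑' n, b n ω := fun i => by
    filter_upwards [hχ, hbd, hsummable] with ω h1 h2 h3
    filter_upwards [h1 i, ae_all_iff.2 (h2 i)] with x hx1 hx2
    rw [hx1, ← Real.norm_eq_abs]
    exact tsum_of_norm_bounded h3.hasSum fun n => (Real.norm_eq_abs _).trans_le (hx2 n)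
  have hχq : ∀ i (q : ℝ≥0∞), 1 ≤ q → q ≤ s → MemLp (fun z => χ z i) q (P.compProd κ) :=
    fun i q hq1 hqs => memLp_compProd_of_bound (hχim i) (Measurable.tsum hbm)
      (memLp_tsum_of_tsum_eLpNorm_ne_top hq1 hbm (hble q hqs)) (hχb i)
  have hχ2 : ∀ i, MemLp (fun z => χ z i) 2 (P.compProd κ) := fun i => hχq i 2 one_le_two h2s
  have hdual : ∀ i, IsDualSum (P.compProd κ) (skewProduct σ T) (fun z => v z i)
      (fun z => χ z i) := fun i =>
    isDualSum_of_bound hσp hτp hT hκ (hvm i) (hv2 i) (hχ2 i) hbm hb0 (hble 2 h2s)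
      (hbd.mono fun ω h => h i) (hχ.mono fun ω h => h i)
  -- a finite exponent larger than `2`
  obtain ⟨q, hq2, hqs⟩ : ∃ q : ℝ, 2 < q ∧ ENNReal.ofReal q ≤ s := by
    obtain ⟨q, hq1, hq2⟩ := ENNReal.lt_iff_exists_nnreal_btwn.1 hs
    exact ⟨q, by exact_mod_cast hq1, by simpa using hq2.le⟩
  have hχint : Integrable (fun z => |χ z γ| ^ q) (P.compProd κ) := by
    have hq1 : 1 ≤ ENNReal.ofReal q := by
      rw [← ENNReal.ofReal_one]
      exact ENNReal.ofReal_le_ofReal (by linarith)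
    have h := (hχq γ _ hq1 hqs).integrable_norm_rpow (by positivity) ENNReal.ofReal_ne_top
    simpa only [ENNReal.toReal_ofReal (by linarith : 0 ≤ q), Real.norm_eq_abs] using h
  have hmcoh : ∀ i, (fun z => martingalePart σ T v χ z i) =
      cohomologous (skewProduct σ T) (fun z => v z i) (fun z => χ z i) := fun i => rfl
  have hm2 : ∀ i, MemLp (fun z => martingalePart σ T v χ z i) 2 (P.compProd κ) := fun i =>
    memLp_cohomologous hτp (hv2 i) (hχ2 i)
  have hmm : Measurable (martingalePart σ T v χ) :=
    (hv.add hχm).sub (hχm.comp hτp.measurable)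
  have hlag : ∀ j : ℕ, Integrable (lagProduct σ T v β γ j) (P.compProd κ) ∧
      Integrable (lagProduct σ T (martingalePart σ T v χ) β γ j) (P.compProd κ) := fun j =>
    ⟨(hv2 β).integrable_mul ((hv2 γ).comp_measurePreserving (hτp.iterate j)),
      (hm2 β).integrable_mul ((hm2 γ).comp_measurePreserving (hτp.iterate j))⟩
  -- The explicit value of the drift, which both the lag sums and the pathwise averages produce.
  set S : ℝ := ∫ z, χ z β * v z γ ∂(P.compProd κ)
  have hS : Tendsto (fun n : ℕ => ∑ j ∈ Finset.Icc 1 n,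
      ∫ z, (lagProduct σ T v β γ j z - lagProduct σ T (martingalePart σ T v χ) β γ j z)
        ∂(P.compProd κ)) atTop (𝓝 S) := by
    have h := tendsto_sum_integral_lag hτp (hχ2 β) (hv2 γ) (hvm γ) (hv2 β) (hχim γ) (hχ2 γ)
      hτp.measurable (hdual β)
    rw [← hmcoh, ← hmcoh] at h
    exact h
  have hunif : ∀ᵐ ω ∂P, ∀ᵐ x ∂(κ ω), ∀ C : Set ℝ≥0, IsCompact C →
      TendstoUniformlyOn (fun (n : ℕ) (t : ℝ≥0) => iteratedProcess σ T v β γ ω n x t -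
        iteratedProcess σ T (martingalePart σ T v χ) β γ ω n x t)
        (fun t => (t : ℝ) * S) atTop C := by
    have h := Measure.ae_ae_of_ae_compProd (ae_tendsto_pairSum_sub_div hτ (hvm β) (hχim β) (hvm γ)
      (hχim γ) (hv2 β) (hχ2 β) (hv2 γ) (hχ2 γ) hq2 hχint (hdual β) (hdual γ))
    filter_upwards [h] with ω h1
    filter_upwards [h1] with x hx C hC
    refine (tendstoUniformlyOn_floor hx hC).congr (Eventually.of_forall fun n t _ => ?_)
    simp only [iteratedProcess, iteratedSum_eq_pairSum, hmcoh]
    ring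
  refine ⟨hlag, ⟨S, hS, hunif⟩, ?_⟩
  have hc : Tendsto (fun n : ℕ => ∑ j ∈ Finset.Icc 1 n, ∫ z, lagProduct σ T v β γ j z
      ∂(P.compProd κ) - ∑ j ∈ Finset.Icc 1 n,
        ∫ z, lagProduct σ T (martingalePart σ T v χ) β γ j z ∂(P.compProd κ)) atTop (𝓝 S) := by
    refine hS.congr fun n => ?_
    rw [← Finset.sum_sub_distrib]
    exact Finset.sum_congr rfl fun j _ => integral_sub (hlag j).1 (hlag j).2
  filter_upwards [hunif] with ω hω Q _
  have hclose := hω.mono fun x hx => tendsto_uniformity_recenteredPath hc hx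
  exact ⟨fun h => tendstoInDistribution_of_ae_tendsto_uniformity h
      (fun n => (measurable_recenteredPath hT hmm ω n _).aemeasurable) hclose,
    fun h => tendstoInDistribution_of_ae_tendsto_uniformity h
      (fun n => (measurable_recenteredPath hT hv ω n _).aemeasurable)
      (hclose.mono fun x hx => tendsto_swap_uniformity.comp hx)⟩

end IteratedWIP

/-! ### The random bound from the decay of the transfer operators -/

theorem mainTheorem4 {Ω M H : Type*}
    [MeasurableSpace Ω] (P : Measure Ω) [IsProbabilityMeasure P]
    -- the ergodic base `(Ω, ℱ, P, σ)`
    (σ : Ω ≃ᵐ Ω) (hσ : Ergodic σ P)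
    -- the fibre maps `T_ω` and the equivariant family `κ ω = μ_ω`
    [MetricSpace M] [MeasurableSpace M] [BorelSpace M]
    (T : Ω → M → M) (hT : Measurable (fun z : Ω × M => T z.1 z.2))
    (κ : Kernel Ω M) [IsMarkovKernel κ]
    (hκ : ∀ᵐ ω ∂P, (κ ω).map (T ω) = κ (σ ω))
    -- `μ(A × B) = ∫_A μ_ω(B) dP(ω)` is ergodic for the skew product
    (hτ : Ergodic (skewProduct σ T) (P.compProd κ))
    -- the Banach space `H` of observables `ι φ : M → ℝ`
    [NormedAddCommGroup H] [NormedSpace ℝ H] [CompleteSpace H]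
    (ι : H →ₗ[ℝ] (M → ℝ)) (hι : Function.Injective ι)
    (hconst : ∀ c : ℝ, ∃ φ : H, ι φ = fun _ => c)
    (hsup : ∀ᵐ ω ∂P, ∀ φ : H, AEStronglyMeasurable (ι φ) (κ ω) ∧
      eLpNorm (ι φ) ∞ (κ ω) ≤ ENNReal.ofReal ‖φ‖)
    (hL : ∀ᵐ ω ∂P, ∃ L : H →L[ℝ] H, ∀ φ : H,
      ι (L φ) =ᵐ[κ (σ ω)] transfer σ T κ ω (ι φ))
    -- decay of the transfer operators
    (K : Ω → ℝ) (hKmeas : Measurable K) (hK : ∀ ω, 1 ≤ K ω)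
    (A : ℕ → Ω → ℝ) (hAmeas : ∀ n, Measurable (A n)) (hA : ∀ n ω, 0 < A n ω)
    (hdecay : ∀ᵐ ω ∂P, ∀ φ : H, ∀ n : ℕ, 1 ≤ n →
      eLpNorm (fun x => transferIter σ T κ n ω (ι φ) x - ∫ y, ι φ y ∂(κ ω)) ∞ (κ (σ^[n] ω)) ≤
        ENNReal.ofReal (K ω * A n ω * ‖φ‖))
    -- the exponents; `r⁻¹ + q₀⁻¹ ≤ 2⁻¹` says that `r ≥ 2 q₀ / (q₀ - 2)`
    (q₀ p r s : ℝ≥0∞) (hq₀ : 4 ≤ q₀)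
    (hAsum : ∑' j : ℕ, eLpNorm (A (j + 1)) q₀ P < ∞)
    (hp : 0 < p) (hr : r⁻¹ + q₀⁻¹ ≤ 2⁻¹) (hs : 2 < s)
    (hprs : s⁻¹ = r⁻¹ + p⁻¹ + q₀⁻¹)
    (hKr : MemLp K r P)
    -- the observable `v`; `V ω` is `v_ω` as an element of `H^e`, with the maximum norm
    {e : ℕ} (v : Ω × M → Fin e → ℝ) (hv : Measurable v)
    (V : Ω → Fin e → H) (hV : ∀ᵐ ω ∂P, ∀ i, ι (V ω i) = fun x => v (ω, x) i)
    (hcentre : ∀ᵐ ω ∂P, ∀ i, ∫ x, v (ω, x) i ∂(κ ω) = 0)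
    (hVp : MemLp (fun ω => ‖V ω‖) p P) :
    -- the series defining `χ_ω` converges absolutely in `L^∞(μ_ω)`
    (∀ᵐ ω ∂P, ∀ i, ∑' n : ℕ, eLpNorm (chiTerm σ T κ v i (n + 1) ω) ∞ (κ ω) < ∞) ∧
    -- it has a jointly measurable version, at least if `M` is separable
    (TopologicalSpace.SeparableSpace M →
      ∃ χ : Ω × M → Fin e → ℝ, Measurable χ ∧ IsChi P σ T κ v χ) ∧
    ∀ χ : Ω × M → Fin e → ℝ, Measurable χ → IsChi P σ T κ v χ →
    ∀ m : Ω × M → Fin e → ℝ, m = martingalePart σ T v χ →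
    ∀ β γ : Fin e,
      (∀ j : ℕ, Integrable (lagProduct σ T v β γ j) (P.compProd κ) ∧
        Integrable (lagProduct σ T m β γ j) (P.compProd κ)) ∧
      (∃ S : ℝ,
        Tendsto (fun n : ℕ => ∑ j ∈ Finset.Icc 1 n,
          ∫ z, (lagProduct σ T v β γ j z - lagProduct σ T m β γ j z) ∂(P.compProd κ))
          atTop (𝓝 S) ∧
        ∀ᵐ ω ∂P, ∀ᵐ x ∂(κ ω), ∀ C : Set ℝ≥0, IsCompact C →
          TendstoUniformlyOn
            (fun (n : ℕ) (t : ℝ≥0) =>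
              iteratedProcess σ T v β γ ω n x t - iteratedProcess σ T m β γ ω n x t)
            (fun t => (t : ℝ) * S) atTop C) ∧
      -- weak limits in the Skorokhod space, as laws `Q` on it
      ∀ᵐ ω ∂P, ∀ (Q : Measure Skorokhod) [IsProbabilityMeasure Q],
        TendstoInDistribution
          (fun (n : ℕ) (x : M) => recenteredPath σ T v β γ ω n
            (∑ j ∈ Finset.Icc 1 n, ∫ z, lagProduct σ T v β γ j z ∂(P.compProd κ)) x)
          atTop id (fun _ => κ ω) Q ↔
        TendstoInDistribution
          (fun (n : ℕ) (x : M) => recenteredPath σ T m β γ ω n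
            (∑ j ∈ Finset.Icc 1 n, ∫ z, lagProduct σ T m β γ j z ∂(P.compProd κ)) x)
          atTop id (fun _ => κ ω) Q := by
  have hσp : MeasurePreserving σ P P := hσ.toMeasurePreserving
  have hτp := hτ.toMeasurePreserving
  have h2s : (2 : ℝ≥0∞) ≤ s := hs.le
  have hs1 : 1 ≤ s := one_le_two.trans h2s
  -- The exponent relation gives $1/p\le1/s\le1/2$; hence $v\in L^2(\mu)$.
  have h2p : (2 : ℝ≥0∞) ≤ p := by
    refine h2s.trans (ENNReal.inv_le_inv.1 ?_)
    rw [hprs, add_assoc]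
    exact le_add_left (le_add_right le_rfl)
  -- a measurable version of `‖V ω‖`
  obtain ⟨W, hWm, hW0, hVW⟩ : ∃ W : Ω → ℝ, Measurable W ∧ (∀ ω, 0 ≤ W ω) ∧
      ∀ᵐ ω ∂P, ‖V ω‖ = W ω := by
    refine ⟨fun ω => |hVp.1.mk _ ω|, hVp.1.stronglyMeasurable_mk.measurable.abs,
      fun ω => abs_nonneg _, ?_⟩
    filter_upwards [hVp.1.ae_eq_mk] with ω hω
    rw [← hω, abs_of_nonneg (norm_nonneg _)]
  have hWp : MemLp W p P := hVp.ae_eq hVW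
  -- the bounds of the terms of the series
  set B : ℕ → Ω → ℝ := fun n ω => K ω * A (n + 1) ω * W ω with hB
  have hBm : ∀ n, Measurable (B n) := fun n => (hKmeas.mul (hAmeas _)).mul hWm
  -- Term $n+1$ of the series starts at $\sigma^{-(n+1)}\omega$, so its bound is evaluated there;
  -- invariance of $\mathbb P$ preserves the $L^s$ norms.
  set b : ℕ → Ω → ℝ := fun n ω => B n (σ.symm^[n + 1] ω) with hb
  have hsymm : ∀ n : ℕ, MeasurePreserving σ.symm^[n] P P := fun n => (hσp.symm σ).iterate n
  have hbm : ∀ n, Measurable (b n) := fun n => (hBm n).comp (hsymm (n + 1)).measurable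
  have hb0 : ∀ n ω, 0 ≤ b n ω := fun n ω =>
    mul_nonneg (mul_nonneg (zero_le_one.trans (hK _)) (hA _ _).le) (hW0 _)
  have hbs : ∑' n, eLpNorm (b n) s P ≠ ∞ := by
    have h := tsum_eLpNorm_mul_ne_top hprs hKr hWp (fun n => hAmeas (n + 1)) hAsum
    refine ne_of_eq_of_ne (tsum_congr fun n => ?_) h
    have hbn : b n = B n ∘ σ.symm^[n + 1] := rfl
    rw [hbn, eLpNorm_comp_measurePreserving (hBm n).aestronglyMeasurable (hsymm (n + 1))]
  have hterm : ∀ᵐ ω ∂P, ∀ (n : ℕ) (i : Fin e),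
      eLpNorm (chiTerm σ T κ v i (n + 1) ω) ∞ (κ ω) ≤ ENNReal.ofReal (b n ω) := by
    have h : ∀ᵐ ω ∂P, ∀ (n : ℕ) (i : Fin e),
        eLpNorm (transferIter σ T κ (n + 1) ω fun x => v (ω, x) i) ∞ (κ (σ^[n + 1] ω)) ≤
          ENNReal.ofReal (B n ω) := by
      filter_upwards [hdecay, hV, hcentre, hVW] with ω h1 h2 h3 h4 n i
      have h5 := h1 (V ω i) (n + 1) n.succ_pos
      -- Since $v_\omega$ is centred, the mean subtracted in the decay estimate is zero.
      simp only [h2 i, h3 i, sub_zero] at h5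
      refine h5.trans (ENNReal.ofReal_le_ofReal ?_)
      refine mul_le_mul_of_nonneg_left ?_
        (mul_nonneg (zero_le_one.trans (hK _)) (hA _ _).le)
      exact (norm_le_pi_norm (V ω) i).trans h4.le
    have hpull := ae_forall_symm_iterate hσp fun _ => h
    filter_upwards [hpull] with ω h1 n i
    have h2 := h1 (n + 1) n i
    rw [iterate_apply_symm_iterate] at h2
    exact h2
  have hsummable : ∀ᵐ ω ∂P, Summable fun n => b n ω := by
    filter_upwards [summable_norm_of_tsum_eLpNorm_ne_top hs1
      (fun n => (hbm n).aestronglyMeasurable) hbs] with ω hω using hω.of_norm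
  have hvm : ∀ i, Measurable fun z => v z i := fun i => (measurable_pi_apply i).comp hv
  have hv2 : ∀ i, MemLp (fun z => v z i) 2 (P.compProd κ) := fun i => by
    refine memLp_compProd_of_bound (hvm i) hWm (hWp.mono_exponent h2p) ?_
    filter_upwards [hsup, hV, hVW] with ω h1 h2 h3
    have h4 := (h1 (V ω i)).2
    rw [h2 i, eLpNorm_exponent_top] at h4
    filter_upwards [ae_le_eLpNormEssSup (f := fun x => v (ω, x) i) (μ := κ ω)] with x hx
    have h5 := hx.trans h4
    rw [← ofReal_norm, ENNReal.ofReal_le_ofReal_iff (norm_nonneg _)] at h5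
    exact h5.trans ((norm_le_pi_norm (V ω) i).trans h3.le)
  refine ⟨?_, ?_, ?_⟩
  · filter_upwards [hterm, hsummable] with ω h1 h2 i
    exact (ENNReal.tsum_le_tsum fun n => h1 n i).trans_lt h2.tsum_ofReal_lt_top
  · intro hsep
    -- Separability enters only to make the Borel $\sigma$-algebra of $M$ countably generated.
    have : SecondCountableTopology M := UniformSpace.secondCountable_of_separable M
    choose U hUm hU using fun (i : Fin e) (n : ℕ) =>
      exists_measurable_pastTransfer hσp hτp hT hκ (hvm i) ((hv2 i).integrable one_le_two) (n + 1)
    refine ⟨fun z i => ∑' n, U i n z, measurable_pi_iff.2 fun i => Measurable.tsum (hUm i), ?_⟩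
    filter_upwards [ae_all_iff.2 fun i => ae_all_iff.2 fun n => hU i n] with ω hω i
    filter_upwards [ae_all_iff.2 (hω i)] with x hx
    exact tsum_congr hx
  intro χ hχm hχ m hm β γ
  subst hm
  have hbd : ∀ᵐ ω ∂P, ∀ (i : Fin e) (n : ℕ), ∀ᵐ x ∂(κ ω),
      |chiTerm σ T κ v i (n + 1) ω x| ≤ b n ω := by
    filter_upwards [hterm] with ω h1 i n
    have h2 := h1 n i
    rw [eLpNorm_exponent_top] at h2
    filter_upwards [ae_le_eLpNormEssSup (f := chiTerm σ T κ v i (n + 1) ω) (μ := κ ω)] with x hx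
    have h5 := hx.trans h2
    rwa [← ofReal_norm, ENNReal.ofReal_le_ofReal_iff (hb0 n ω)] at h5
  exact iteratedProcess_limits_of_bound hσp hT hκ hτ hs hv hv2 hbm hb0 hbs hbd hχm hχ β γ
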